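/- Let $n\ge 1$ and let $M=\{x\in\mathbb{R}^n : x_i>0,\ \sum_i x_i=1\}$ carry the Shahshahani metric $\langle u,v\rangle_x=\sum_i u_iv_i/x_i$ on tangent vectors ($\sum_i u_i=\sum_i v_i=0$), with Riemannian distance $d$, volume $d\mathrm{Vol}$, gradient $\mathrm{grad}$ and (Levi-Civita) parallel transport $\Gamma_x^y$ along the geodesic from $x$ to $y$. Let $L>0$ and let $f:M\to\mathbb{R}$ be differentiable and geodesically $L$-smooth, i.e. $\|\mathrm{grad} f(y)-\Gamma_x^y\,\mathrm{grad} f(x)\|_y\le L\,d(x,y)$ for all $x,y\in M$, and suppose that $f$ attains its minimum $f^*$ over $M$ at a point $x^*\in M$. For $\beta>0$ let $$\Lambda=\int_M e^{-\beta f}\,d\mathrm{Vol},\qquad \nu=\nu_\beta=\frac{e^{-\beta f}}{\Lambda},\qquad \mathbb{E}_\nu f=\int_M f\nu\,d\mathrm{Vol},\qquad h(\nu)=-\int_M\nu\log\nu\,d\mathrm{Vol}.$$ Let $B\subseteq(0,\infty)$ be a set of values of $\beta$ (for instance all of them), and suppose that the entropy is bounded uniformly: $h(\nu_\beta)\le K<\infty$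 for all $\beta\in B$. Then $$|\mathbb{E}_\nu f-f^*|\le\frac{K}{\beta}+\frac1\beta\log\left(\mathrm{poly}\left(\tfrac1\beta\right)^{-1}\right),\qquad \mathrm{poly}\left(\tfrac1\beta\right)=c\left(\frac{1}{\beta L}\right)^{\frac{n-1}{2}},$$ for all $\beta\in B$ that are not too small, in the following two senses. (1) For every $s_0>0$ there is a constant $c>0$, depending only on $n$ and $s_0$, such that for all $L$, $f$, $x^*$, $B$ and $K$ as above the bound holds for all $\beta\in B$ with $\beta L\ge s_0$; moreover, for these $\beta$, $0<\Lambda<\infty$ and the integrals that define $\mathbb{E}_\nu f$ and $h(\nu)$ converge absolutely. (2) For every $x^*\in M$ and every positive $c<(2\pi)^{(n-1)/2}$ there is $s_0>0$, depending only on $n$, $x^*$ and $c$, such that for all $L$, $f$ (with minimiser $x^*$), $B$ and $K$ as above the bound holds with this $c$ for all $\beta\in B$ with $\beta L\ge s_0$. -/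

import Mathlib

namespace Shahshahani

/-- The open simplex `{x ∈ ℝⁿ : xᵢ > 0, ∑ xᵢ = 1}` with `n = d + 1`; its dimension is `d`. -/
def openSimplex (d : ℕ) : Set (Fin (d + 1) → ℝ) :=
  {x | (∀ i, 0 < x i) ∧ ∑ i, x i = 1}

/-- The Shahshahani inner product `⟨u, v⟩ₓ = ∑ uᵢ vᵢ / xᵢ`. The tangent space of the simplex
is the hyperplane `∑ vᵢ = 0`. -/
noncomputable def innerAt {d : ℕ} (x u v : Fin (d + 1) → ℝ) : ℝ :=
  ∑ i, u i * v i / x i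

/-- The Shahshahani norm `‖v‖ₓ`. -/
noncomputable def normAt {d : ℕ} (x v : Fin (d + 1) → ℝ) : ℝ :=
  Real.sqrt (innerAt x v v)

/-- `w` is the Riemannian gradient of `f` at `x`: it is tangent to the simplex, and `f`,
restricted to the simplex, is differentiable at `x` with differential `v ↦ ⟨w, v⟩ₓ`. -/
def HasGradAt {d : ℕ} (f : (Fin (d + 1) → ℝ) → ℝ) (w x : Fin (d + 1) → ℝ) : Prop :=
  ∑ i, w i = 0 ∧
    HasFDerivWithinAt f
      (∑ i, (w i / x i) • (ContinuousLinearMap.proj i : (Fin (d + 1) → ℝ) →L[ℝ] ℝ))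
      (openSimplex d) x

/-- The velocity of a curve `γ : [0, 1] → ℝⁿ` (one-sided at the end points). -/
noncomputable def velocity {d : ℕ} (γ : ℝ → Fin (d + 1) → ℝ) (t : ℝ) : Fin (d + 1) → ℝ :=
  derivWithin γ (Set.Icc 0 1) t

/-- The Riemannian length of a curve on `[0, 1]`. -/
noncomputable def curveLength {d : ℕ} (γ : ℝ → Fin (d + 1) → ℝ) : ℝ :=
  ∫ t in (0 : ℝ)..1, normAt (γ t) (velocity γ t)

/-- The Riemannian distance: the infimum of the lengths of the `C¹` curves in the simplex that
join the two points. -/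
noncomputable def riemDist {d : ℕ} (x y : Fin (d + 1) → ℝ) : ℝ :=
  sInf {l : ℝ | ∃ γ : ℝ → Fin (d + 1) → ℝ, ContDiffOn ℝ 1 γ (Set.Icc 0 1) ∧
    (∀ t ∈ Set.Icc (0 : ℝ) 1, γ t ∈ openSimplex d) ∧ γ 0 = x ∧ γ 1 = y ∧ l = curveLength γ}

/-- The covariant derivative along `γ`, with respect to the Levi-Civita connection of the metric
`∑ (dxᵢ)² / xᵢ` on the positive orthant, of a vector field `V` along `γ`. The only
non-zero Christoffel symbols of this diagonal metric are `Γⁱᵢᵢ = -1 / (2 xᵢ)`. -/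
noncomputable def orthantCovDeriv {d : ℕ} (γ V : ℝ → Fin (d + 1) → ℝ) (t : ℝ) :
    Fin (d + 1) → ℝ :=
  fun i => derivWithin V (Set.Icc 0 1) t i - velocity γ t i * V t i / (2 * γ t i)

/-- The projection of `w` onto the tangent space `∑ vᵢ = 0`, orthogonal for `⟨·, ·⟩ₓ`, at a point
`x` of the simplex: the unit normal vector is `x` itself, since `⟨w, x⟩ₓ = ∑ wᵢ`. -/
noncomputable def tangentProj {d : ℕ} (x w : Fin (d + 1) → ℝ) : Fin (d + 1) → ℝ :=
  w - (∑ i, w i) • x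

/-- The covariant derivative along a curve in the simplex: the Levi-Civita connection of a
Riemannian submanifold is the tangential part of the ambient one. -/
noncomputable def covDeriv {d : ℕ} (γ V : ℝ → Fin (d + 1) → ℝ) (t : ℝ) : Fin (d + 1) → ℝ :=
  tangentProj (γ t) (orthantCovDeriv γ V t)

/-- `V` is a parallel tangent vector field along the curve `γ : [0, 1] → simplex`. -/
def IsParallelAlong {d : ℕ} (γ V : ℝ → Fin (d + 1) → ℝ) : Prop :=
  DifferentiableOn ℝ V (Set.Icc 0 1) ∧
    ∀ t ∈ Set.Icc (0 : ℝ) 1, ∑ i, V t i = 0 ∧ covDeriv γ V t = 0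

/-- `γ : [0, 1] → simplex` is a geodesic: its velocity is parallel along it. -/
def IsGeodesic {d : ℕ} (γ : ℝ → Fin (d + 1) → ℝ) : Prop :=
  ContDiffOn ℝ 2 γ (Set.Icc 0 1) ∧ (∀ t ∈ Set.Icc (0 : ℝ) 1, γ t ∈ openSimplex d) ∧
    IsParallelAlong γ (velocity γ)

/-- `f` is geodesically `L`-smooth: it is differentiable on the simplex, and
`‖grad f(y) - Γₓʸ grad f(x)‖ ≤ L d(x, y)` for all `x, y`, where `Γₓʸ` is the parallel transport
along the geodesic from `x` to `y`. -/
def IsGeodesicallySmooth {d : ℕ} (L : ℝ) (f : (Fin (d + 1) → ℝ) → ℝ) : Prop :=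
  ∃ grad : (Fin (d + 1) → ℝ) → Fin (d + 1) → ℝ,
    (∀ x ∈ openSimplex d, HasGradAt f (grad x) x) ∧
    ∀ x ∈ openSimplex d, ∀ y ∈ openSimplex d, ∀ γ V : ℝ → Fin (d + 1) → ℝ,
      IsGeodesic γ → γ 0 = x → γ 1 = y → IsParallelAlong γ V → V 0 = grad x →
        normAt y (grad y - V 1) ≤ L * riemDist x y

/-- The inverse of the global chart `x ↦ (x₁, …, x_d)` of the simplex. -/
noncomputable def chartInv {d : ℕ} (u : Fin d → ℝ) : Fin (d + 1) → ℝ :=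
  Fin.snoc (α := fun _ => ℝ) u (1 - ∑ i, u i)

/-- The coordinate vector field `∂ / ∂uᵢ` of this chart. -/
def coordVec {d : ℕ} (i : Fin d) : Fin (d + 1) → ℝ :=
  Pi.single i.castSucc 1 - Pi.single (Fin.last d) 1

/-- The matrix `gᵢⱼ` of the Shahshahani metric in this chart. -/
noncomputable def metricMatrix {d : ℕ} (u : Fin d → ℝ) : Matrix (Fin d) (Fin d) ℝ :=
  Matrix.of fun i j => innerAt (chartInv u) (coordVec i) (coordVec j)

/-- The Riemannian volume of the simplex, `√(det g) du₁ ⋯ du_d` in the chart, as a measure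
on `ℝⁿ`. -/
noncomputable def vol (d : ℕ) : MeasureTheory.Measure (Fin (d + 1) → ℝ) :=
  (((MeasureTheory.volume : MeasureTheory.Measure (Fin d → ℝ)).restrict
      (chartInv ⁻¹' openSimplex d)).withDensity
        fun u => ENNReal.ofReal (Real.sqrt (metricMatrix u).det)).map chartInv

/-- The partition function `Λ = ∫ exp (-β f) dVol`. -/
noncomputable def partitionFn {d : ℕ} (f : (Fin (d + 1) → ℝ) → ℝ) (β : ℝ) : ℝ :=
  ∫ x, Real.exp (-β * f x) ∂(vol d)

/-- The Gibbs density `ν = exp (-β f) / Λ` with respect to the Riemannian volume. -/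
noncomputable def gibbs {d : ℕ} (f : (Fin (d + 1) → ℝ) → ℝ) (β : ℝ) (x : Fin (d + 1) → ℝ) : ℝ :=
  Real.exp (-β * f x) / partitionFn f β

/-- The expectation of `f` under the Gibbs density. -/
noncomputable def gibbsMean {d : ℕ} (f : (Fin (d + 1) → ℝ) → ℝ) (β : ℝ) : ℝ :=
  ∫ x, f x * gibbs f β x ∂(vol d)

/-- The differential entropy `h(ν) = -∫ ν log ν dVol` of the Gibbs density. -/
noncomputable def gibbsEntropy {d : ℕ} (f : (Fin (d + 1) → ℝ) → ℝ) (β : ℝ) : ℝ :=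
  -∫ x, gibbs f β x * Real.log (gibbs f β x) ∂(vol d)

/-- All integrals in the definition of the Gibbs density, of its mean and of its entropy
converge, and the partition function is positive. -/
def GibbsWellDefined {d : ℕ} (f : (Fin (d + 1) → ℝ) → ℝ) (β : ℝ) : Prop :=
  MeasureTheory.Integrable (fun x => Real.exp (-β * f x)) (vol d) ∧
  0 < partitionFn f β ∧
  MeasureTheory.Integrable (fun x => f x * gibbs f β x) (vol d) ∧
  MeasureTheory.Integrable (fun x => gibbs f β x * Real.log (gibbs f β x)) (vol d)

end Shahshahani

/-!
The Gibbs density satisfies `log ν = -β f - log Λ`, hence `h(ν) = β 𝔼 f + log Λ`, and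
`𝔼 f - f* = (h(ν) - log (Λ exp (β f*))) / β`. It remains to bound
`Λ exp (β f*) = ∫ exp (-β (f - f*)) dVol` from below.

At the interior minimiser `x*` the gradient vanishes, and so do its parallel transports; the
smoothness inequality therefore reads `‖grad f y‖ ≤ L d(x*, y)`, and integration along the geodesic
gives `f y ≤ f* + L d(x*, y)² / 2` (`le_add_angle_sq`). The map `σ ↦ σ²` identifies the positive
orthant of the unit sphere, with its distances doubled, with the simplex; the geodesics are
the squares of great circle arcs and `d(x, y)` is twice the angle between `√x` and `√y`
(`isGeodesic_greatCircle`, `curveLength_greatCircle`). Only the upper bound of `d` by the length of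
these arcs is needed. Thus, with `s = β L`, everything follows (`gibbs_bound`) from lower bounds of
`laplaceIntegral s x* = ∫ exp (-s d(x*, y)² / 2) dVol(y)` by multiples of `s ^ (-d / 2)`, where `d`
is now the dimension.

* Uniformly in `x*` (`exists_le_laplaceIntegral`): the volume has density `∏ xᵢ ^ (-1/2)` in the
  chart and is invariant under the exchange of a coordinate with the last one
  (`lintegral_vol_comp_swap`), so the last coordinate of `x*` may be assumed to be at least
  `1 / (d + 1)`. The box `√x*ᵢ ≤ √yᵢ ≤ √x*ᵢ + r` (`i ≠ n`) has volume at least `r ^ d` and lies within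
  distance `O(r)` of `x*`, however close to the boundary `x*` may be; take `r` proportional to
  `s ^ (-1/2)`.
* Asymptotically (`exists_laplaceIntegral_ge_of_lt`): after rescaling by `s ^ (-1/2)` at `x*` the
  integrands converge to a Gaussian on the tangent space, whose integral is `(2π) ^ (d/2)`, and
  Fatou's lemma applies.

The same symmetry shows that the volume is finite (`isFiniteMeasure_vol`), whence the convergence of
the integrals.
-/

namespace Shahshahani

open Set Filter Topology MeasureTheory
open scoped ENNReal

variable {d : ℕ}

/-! ### Great circles and quadratic growth at the minimiser -/

/-- The curve `t ↦ (cos (a t) p + sin (a t) w)²` (squares taken coordinatewise): the image of an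
arc of the great circle through `p` with direction `w` under the isometry `σ ↦ σ²` from the
positive orthant of the unit sphere, with its distances doubled, to the simplex. -/
noncomputable def greatCircle (p w : Fin (d + 1) → ℝ) (a t : ℝ) : Fin (d + 1) → ℝ :=
  fun i => (Real.cos (a * t) * p i + Real.sin (a * t) * w i) ^ 2

lemma hasDerivAt_arc (p w a t : ℝ) :
    HasDerivAt (fun t => Real.cos (a * t) * p + Real.sin (a * t) * w)
      (a * (-Real.sin (a * t) * p + Real.cos (a * t) * w)) t := by
  have h : HasDerivAt (fun t : ℝ => a * t) a t := by simpa using (hasDerivAt_id t).const_mul a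
  convert! (h.cos.mul_const p).add (h.sin.mul_const w) using 1
  ring

lemma hasDerivAt_arc_deriv (p w a t : ℝ) :
    HasDerivAt (fun t => -Real.sin (a * t) * p + Real.cos (a * t) * w)
      (-a * (Real.cos (a * t) * p + Real.sin (a * t) * w)) t := by
  have h : HasDerivAt (fun t : ℝ => a * t) a t := by simpa using (hasDerivAt_id t).const_mul a
  convert! (h.sin.neg.mul_const p).add (h.cos.mul_const w) using 1
  ring

lemma hasDerivAt_greatCircle (p w : Fin (d + 1) → ℝ) (a t : ℝ) :
    HasDerivAt (greatCircle p w a)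
      (fun i => 2 * (Real.cos (a * t) * p i + Real.sin (a * t) * w i) *
        (a * (-Real.sin (a * t) * p i + Real.cos (a * t) * w i))) t := by
  rw [hasDerivAt_pi]
  intro i
  convert! (hasDerivAt_arc (p i) (w i) a t).pow 2 using 1
  norm_num

lemma contDiff_greatCircle (p w : Fin (d + 1) → ℝ) (a : ℝ) (k : ℕ) :
    ContDiff ℝ k (greatCircle p w a) := by
  unfold greatCircle
  fun_prop

lemma velocity_greatCircle (p w : Fin (d + 1) → ℝ) (a : ℝ) {t : ℝ} (ht : t ∈ Icc (0 : ℝ) 1) :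
    velocity (greatCircle p w a) t = fun i =>
      2 * (Real.cos (a * t) * p i + Real.sin (a * t) * w i) *
        (a * (-Real.sin (a * t) * p i + Real.cos (a * t) * w i)) :=
  (hasDerivAt_greatCircle p w a t).hasDerivWithinAt.derivWithin (uniqueDiffOn_Icc zero_lt_one t ht)

lemma hasDerivWithinAt_velocity_greatCircle (p w : Fin (d + 1) → ℝ) (a : ℝ) {t : ℝ}
    (ht : t ∈ Icc (0 : ℝ) 1) :
    HasDerivWithinAt (velocity (greatCircle p w a))
      (fun i => 2 * (a * (-Real.sin (a * t) * p i + Real.cos (a * t) * w i)) ^ 2 -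
        2 * a ^ 2 * (Real.cos (a * t) * p i + Real.sin (a * t) * w i) ^ 2) (Icc 0 1) t := by
  refine HasDerivWithinAt.congr_of_mem ?_ (fun s hs => velocity_greatCircle p w a hs) ht
  refine (hasDerivAt_pi.2 fun i => ?_).hasDerivWithinAt
  convert! ((hasDerivAt_arc (p i) (w i) a t).const_mul 2).mul
    ((hasDerivAt_arc_deriv (p i) (w i) a t).const_mul a) using 1
  ring

section Orthonormal

variable {p w : Fin (d + 1) → ℝ} (hp : ∑ i, p i ^ 2 = 1) (hw : ∑ i, w i ^ 2 = 1)
  (hpw : ∑ i, p i * w i = 0)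

include hp hw hpw

lemma sum_sq_combination (b c : ℝ) : ∑ i, (b * p i + c * w i) ^ 2 = b ^ 2 + c ^ 2 := by
  have : ∀ i, (b * p i + c * w i) ^ 2 =
      b ^ 2 * p i ^ 2 + c ^ 2 * w i ^ 2 + 2 * b * c * (p i * w i) := fun i => by ring
  simp_rw [this, Finset.sum_add_distrib, ← Finset.mul_sum, hp, hw, hpw]
  ring

lemma sum_mul_combination (b c : ℝ) :
    ∑ i, (b * p i + c * w i) * (-c * p i + b * w i) = 0 := by
  have : ∀ i, (b * p i + c * w i) * (-c * p i + b * w i) =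
      (-b * c) * p i ^ 2 + (b * c) * w i ^ 2 + (b ^ 2 - c ^ 2) * (p i * w i) := fun i => by ring
  simp_rw [this, Finset.sum_add_distrib, ← Finset.mul_sum, hp, hw, hpw]
  ring

lemma sum_sq_arc_deriv (a t : ℝ) :
    ∑ i, (-Real.sin (a * t) * p i + Real.cos (a * t) * w i) ^ 2 = 1 := by
  rw [sum_sq_combination hp hw hpw]
  nlinarith [Real.sin_sq_add_cos_sq (a * t)]

lemma greatCircle_mem_openSimplex {a t : ℝ}
    (hpos : ∀ i, 0 < Real.cos (a * t) * p i + Real.sin (a * t) * w i) :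
    greatCircle p w a t ∈ openSimplex d := by
  refine ⟨fun i => pow_pos (hpos i) 2, ?_⟩
  simp only [greatCircle]
  rw [sum_sq_combination hp hw hpw, Real.cos_sq_add_sin_sq]

lemma sum_velocity_greatCircle (a : ℝ) {t : ℝ} (ht : t ∈ Icc (0 : ℝ) 1) :
    ∑ i, velocity (greatCircle p w a) t i = 0 := by
  rw [velocity_greatCircle p w a ht]
  have h := sum_mul_combination hp hw hpw (Real.cos (a * t)) (Real.sin (a * t))
  calc _ = 2 * a * ∑ i, (Real.cos (a * t) * p i + Real.sin (a * t) * w i) *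
        (-Real.sin (a * t) * p i + Real.cos (a * t) * w i) := by
        rw [Finset.mul_sum]; exact Finset.sum_congr rfl fun i _ => by ring
    _ = 0 := by rw [h, mul_zero]

/-- Squared arcs of great circles are geodesics of the simplex: the acceleration in the orthant
is `-2 a²` times the position, hence normal to the simplex. -/
lemma isGeodesic_greatCircle {a : ℝ}
    (hpos : ∀ t ∈ Icc (0 : ℝ) 1, ∀ i, 0 < Real.cos (a * t) * p i + Real.sin (a * t) * w i) :
    IsGeodesic (greatCircle p w a) := by
  refine ⟨(contDiff_greatCircle p w a 2).contDiffOn,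
    fun t ht => greatCircle_mem_openSimplex hp hw hpw (hpos t ht),
    fun t ht => (hasDerivWithinAt_velocity_greatCircle p w a ht).differentiableWithinAt,
    fun t ht => ⟨sum_velocity_greatCircle hp hw hpw a ht, ?_⟩⟩
  have hacc : orthantCovDeriv (greatCircle p w a) (velocity (greatCircle p w a)) t =
      fun i => (-2 * a ^ 2) * greatCircle p w a t i := by
    funext i
    have hi := (hpos t ht i).ne'
    simp only [orthantCovDeriv, velocity_greatCircle p w a ht,
      (hasDerivWithinAt_velocity_greatCircle p w a ht).derivWithin
        (uniqueDiffOn_Icc zero_lt_one t ht), greatCircle]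
    generalize Real.cos (a * t) * p i + Real.sin (a * t) * w i = u at hi
    generalize -Real.sin (a * t) * p i + Real.cos (a * t) * w i = v
    field_simp
    ring
  have hsum := (greatCircle_mem_openSimplex hp hw hpw (hpos t ht)).2
  rw [covDeriv, hacc, tangentProj, ← Finset.mul_sum, hsum]
  funext i
  simp

lemma normAt_velocity_greatCircle {a t : ℝ} (ha : 0 ≤ a) (ht : t ∈ Icc (0 : ℝ) 1)
    (hpos : ∀ i, 0 < Real.cos (a * t) * p i + Real.sin (a * t) * w i) :
    normAt (greatCircle p w a t) (velocity (greatCircle p w a) t) = 2 * a := by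
  have h : innerAt (greatCircle p w a t) (velocity (greatCircle p w a) t)
      (velocity (greatCircle p w a) t) = (2 * a) ^ 2 := by
    rw [velocity_greatCircle p w a ht, innerAt]
    calc _ = (2 * a) ^ 2 * ∑ i, (-Real.sin (a * t) * p i + Real.cos (a * t) * w i) ^ 2 := by
          rw [Finset.mul_sum]
          refine Finset.sum_congr rfl fun i _ => ?_
          have hi := (hpos i).ne'
          simp only [greatCircle]
          field_simp
      _ = _ := by rw [sum_sq_arc_deriv hp hw hpw, mul_one]
  rw [normAt, h, Real.sqrt_sq (by positivity)]

lemma curveLength_greatCircle {a : ℝ} (ha : 0 ≤ a)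
    (hpos : ∀ t ∈ Icc (0 : ℝ) 1, ∀ i, 0 < Real.cos (a * t) * p i + Real.sin (a * t) * w i) :
    curveLength (greatCircle p w a) = 2 * a := by
  rw [curveLength, intervalIntegral.integral_congr (g := fun _ => 2 * a)]
  · simp
  · intro t ht
    rw [uIcc_of_le zero_le_one] at ht
    exact normAt_velocity_greatCircle hp hw hpw ha ht (hpos t ht)

end Orthonormal

lemma riemDist_le_curveLength {x y : Fin (d + 1) → ℝ} {γ : ℝ → Fin (d + 1) → ℝ}
    (hγ : ContDiffOn ℝ 1 γ (Icc 0 1)) (hmem : ∀ t ∈ Icc (0 : ℝ) 1, γ t ∈ openSimplex d)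
    (h0 : γ 0 = x) (h1 : γ 1 = y) : riemDist x y ≤ curveLength γ := by
  refine csInf_le ⟨0, ?_⟩ ⟨γ, hγ, hmem, h0, h1, rfl⟩
  rintro _ ⟨γ, -, -, -, -, rfl⟩
  exact intervalIntegral.integral_nonneg zero_le_one fun t _ => Real.sqrt_nonneg _

/-- The gradient at an interior minimiser vanishes. -/
lemma HasGradAt.eq_zero_of_isMinOn {f : (Fin (d + 1) → ℝ) → ℝ} {w x : Fin (d + 1) → ℝ}
    (h : HasGradAt f w x) (hx : x ∈ openSimplex d) (hmin : IsMinOn f (openSimplex d) x) :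
    w = 0 := by
  have hline : HasDerivAt (fun t : ℝ => x + t • w) w 0 := by
    simpa using ((hasDerivAt_id (0 : ℝ)).smul_const w).const_add x
  have hmem : ∀ᶠ t : ℝ in 𝓝 0, x + t • w ∈ openSimplex d := by
    have h1 : ∀ᶠ t : ℝ in 𝓝 0, ∀ i, 0 < (x + t • w) i := by
      rw [eventually_all]
      intro i
      have hc : ContinuousAt (fun t : ℝ => (x + t • w) i) 0 := by
        simp only [Pi.add_apply, Pi.smul_apply, smul_eq_mul]; fun_prop
      exact hc.eventually (lt_mem_nhds (by simpa using hx.1 i))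
    filter_upwards [h1] with t ht
    refine ⟨ht, ?_⟩
    simp [Finset.sum_add_distrib, ← Finset.mul_sum, hx.2, h.1]
  have hd : HasDerivAt (fun t : ℝ => f (x + t • w)) (innerAt x w w) 0 := by
    have h2 := h.2
    rw [show x = x + (0 : ℝ) • w by simp] at h2
    have h3 := h2.comp_hasDerivWithinAt (0 : ℝ) (s := {t : ℝ | x + t • w ∈ openSimplex d})
      hline.hasDerivWithinAt (fun t ht => ht)
    have h4 := h3.hasDerivAt hmem
    convert! h4 using 1
    simp [innerAt, div_mul_eq_mul_div]
  have hloc : IsLocalMin (fun t : ℝ => f (x + t • w)) 0 := by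
    filter_upwards [hmem] with t ht
    simpa using hmin ht
  have hz := hloc.hasDerivAt_eq_zero hd
  rw [innerAt, Finset.sum_eq_zero_iff_of_nonneg
    (fun i _ => div_nonneg (mul_self_nonneg _) (hx.1 i).le)] at hz
  funext i
  have := hz i (Finset.mem_univ i)
  rcases div_eq_zero_iff.1 this with h | h
  · simpa using h
  · exact absurd h (hx.1 i).ne'

lemma innerAt_le_normAt_mul_normAt {x : Fin (d + 1) → ℝ} (hx : ∀ i, 0 < x i)
    (u v : Fin (d + 1) → ℝ) : innerAt x u v ≤ normAt x u * normAt x v := by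
  have h := Real.sum_mul_le_sqrt_mul_sqrt Finset.univ (fun i => u i / √(x i))
    (fun i => v i / √(x i))
  have h1 : ∀ i, √(x i) ^ 2 = x i := fun i => Real.sq_sqrt (hx i).le
  have h2 : ∀ a b : Fin (d + 1) → ℝ, ∀ i, a i / √(x i) * (b i / √(x i)) = a i * b i / x i :=
    fun a b i => by rw [div_mul_div_comm, ← sq √(x i), h1]
  have h3 : ∀ a : Fin (d + 1) → ℝ, ∀ i, (a i / √(x i)) ^ 2 = a i * a i / x i :=
    fun a i => by rw [div_pow, h1, sq]
  simp only [h2, h3] at h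
  exact h

/-- Quadratic growth along a great circle that starts at the minimiser `p²`: the gradient at the
point of parameter `t` has norm at most `L` times the length `2 a t` of the arc. -/
lemma le_add_of_greatCircle {L : ℝ} {f : (Fin (d + 1) → ℝ) → ℝ} (hL : 0 ≤ L)
    (hf : IsGeodesicallySmooth L f) {p w : Fin (d + 1) → ℝ} (hp : ∑ i, p i ^ 2 = 1)
    (hw : ∑ i, w i ^ 2 = 1) (hpw : ∑ i, p i * w i = 0) {a : ℝ} (ha : 0 ≤ a)
    (hpos : ∀ t ∈ Icc (0 : ℝ) 1, ∀ i, 0 < Real.cos (a * t) * p i + Real.sin (a * t) * w i)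
    (hmin : IsMinOn f (openSimplex d) (greatCircle p w a 0)) :
    f (greatCircle p w a 1) ≤ f (greatCircle p w a 0) + 2 * L * a ^ 2 := by
  obtain ⟨grad, hgrad, hsmooth⟩ := hf
  have hmem : ∀ t ∈ Icc (0 : ℝ) 1, greatCircle p w a t ∈ openSimplex d := fun t ht =>
    greatCircle_mem_openSimplex hp hw hpw (hpos t ht)
  have h00 : (0 : ℝ) ∈ Icc (0 : ℝ) 1 := ⟨le_rfl, zero_le_one⟩
  have hgrad0 := (hgrad _ (hmem 0 h00)).eq_zero_of_isMinOn (hmem 0 h00) hmin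
  have hbound : ∀ t ∈ Icc (0 : ℝ) 1,
      normAt (greatCircle p w a t) (grad (greatCircle p w a t)) ≤ L * (2 * (a * t)) := by
    intro t ht
    -- The arc up to the parameter `t`, rescaled to `[0, 1]`, is the great circle of speed `a t`.
    have hpos' : ∀ s ∈ Icc (0 : ℝ) 1, ∀ i,
        0 < Real.cos (a * t * s) * p i + Real.sin (a * t * s) * w i := by
      intro s hs i
      rw [mul_assoc]
      exact hpos (t * s) ⟨mul_nonneg ht.1 hs.1, mul_le_one₀ ht.2 hs.1 hs.2⟩ i
    have hgeo := isGeodesic_greatCircle hp hw hpw hpos'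
    have e0 : greatCircle p w (a * t) 0 = greatCircle p w a 0 := by
      funext i; simp [greatCircle]
    have e1 : greatCircle p w (a * t) 1 = greatCircle p w a t := by
      funext i; simp [greatCircle]
    have hpar : IsParallelAlong (greatCircle p w (a * t)) (fun _ => 0) := by
      refine ⟨differentiableOn_const _, fun s _ => ⟨by simp, ?_⟩⟩
      funext i
      simp [covDeriv, tangentProj, orthantCovDeriv]
    have h := hsmooth _ (hmem 0 h00) _ (hmem t ht) _ _ hgeo e0 e1 hpar hgrad0.symm
    rw [sub_zero] at h
    refine h.trans (mul_le_mul_of_nonneg_left ?_ hL)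
    rw [← curveLength_greatCircle hp hw hpw (mul_nonneg ha ht.1) hpos']
    exact riemDist_le_curveLength (contDiff_greatCircle p w _ 1).contDiffOn hgeo.2.1 e0 e1
  have hderiv : ∀ t ∈ Icc (0 : ℝ) 1, HasDerivWithinAt (fun t => f (greatCircle p w a t))
      (innerAt (greatCircle p w a t) (grad (greatCircle p w a t))
        (velocity (greatCircle p w a) t)) (Icc 0 1) t := by
    intro t ht
    have h := (hgrad _ (hmem t ht)).2.comp_hasDerivWithinAt t
      (hasDerivAt_greatCircle p w a t).hasDerivWithinAt hmem
    convert! h using 1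
    rw [velocity_greatCircle p w a ht]
    simp [innerAt, div_mul_eq_mul_div]
  -- The derivative of `f` along the arc is at most `(2 L a t) * (2 a)`, that of `2 L a² t²`.
  have hmono : AntitoneOn (fun t => f (greatCircle p w a t) - 2 * L * a ^ 2 * t ^ 2)
      (Icc 0 1) := by
    have hd : ∀ t ∈ Icc (0 : ℝ) 1,
        HasDerivWithinAt (fun t => f (greatCircle p w a t) - 2 * L * a ^ 2 * t ^ 2)
          (innerAt (greatCircle p w a t) (grad (greatCircle p w a t))
            (velocity (greatCircle p w a) t) - 2 * L * a ^ 2 * (2 * t)) (Icc 0 1) t := by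
      intro t ht
      have h2 : HasDerivAt (fun t : ℝ => 2 * L * a ^ 2 * t ^ 2) (2 * L * a ^ 2 * (2 * t)) t := by
        simpa using (hasDerivAt_pow 2 t).const_mul (2 * L * a ^ 2)
      exact (hderiv t ht).sub h2.hasDerivWithinAt
    refine antitoneOn_of_hasDerivWithinAt_nonpos (convex_Icc 0 1)
      (fun t ht => (hd t ht).continuousWithinAt)
      (fun t ht => (hd t (interior_subset ht)).mono interior_subset) fun t ht => ?_
    have ht' : t ∈ Icc (0 : ℝ) 1 := interior_subset ht
    have h1 := innerAt_le_normAt_mul_normAt (hmem t ht').1 (grad (greatCircle p w a t))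
      (velocity (greatCircle p w a) t)
    rw [normAt_velocity_greatCircle hp hw hpw ha ht' (hpos t ht')] at h1
    have h2 := mul_le_mul_of_nonneg_right (hbound t ht') (by positivity : 0 ≤ 2 * a)
    linarith
  have h := hmono h00 ⟨zero_le_one, le_rfl⟩ zero_le_one
  norm_num at h
  linarith

/-- The chordal distance between the points `√x` and `√y` of the unit sphere. -/
noncomputable def chord (x y : Fin (d + 1) → ℝ) : ℝ :=
  √(∑ i, (√(x i) - √(y i)) ^ 2)

/-- The angle between the points `√x` and `√y` of the unit sphere; the Riemannian distance
from `x` to `y` is twice this angle. -/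
noncomputable def angle (x y : Fin (d + 1) → ℝ) : ℝ :=
  2 * Real.arcsin (chord x y / 2)

lemma sum_sq_sqrt {x : Fin (d + 1) → ℝ} (hx : x ∈ openSimplex d) : ∑ i, √(x i) ^ 2 = 1 := by
  rw [← hx.2]
  exact Finset.sum_congr rfl fun i _ => Real.sq_sqrt (hx.1 i).le

lemma chord_sq (x y : Fin (d + 1) → ℝ) : chord x y ^ 2 = ∑ i, (√(x i) - √(y i)) ^ 2 :=
  Real.sq_sqrt (Finset.sum_nonneg fun _ _ => sq_nonneg _)

lemma chord_nonneg (x y : Fin (d + 1) → ℝ) : 0 ≤ chord x y := Real.sqrt_nonneg _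

lemma chord_sq_eq {x y : Fin (d + 1) → ℝ} (hx : x ∈ openSimplex d) (hy : y ∈ openSimplex d) :
    chord x y ^ 2 = 2 - 2 * ∑ i, √(x i) * √(y i) := by
  have : ∀ i, (√(x i) - √(y i)) ^ 2 = √(x i) ^ 2 + √(y i) ^ 2 - 2 * (√(x i) * √(y i)) :=
    fun i => by ring
  rw [chord_sq]
  simp_rw [this, Finset.sum_sub_distrib, Finset.sum_add_distrib, sum_sq_sqrt hx, sum_sq_sqrt hy,
    ← Finset.mul_sum]
  norm_num

lemma angle_nonneg (x y : Fin (d + 1) → ℝ) : 0 ≤ angle x y :=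
  mul_nonneg zero_le_two (Real.arcsin_nonneg.2 (div_nonneg (chord_nonneg x y) zero_le_two))

lemma angle_le_pi (x y : Fin (d + 1) → ℝ) : angle x y ≤ Real.pi := by
  have := Real.arcsin_le_pi_div_two (chord x y / 2)
  unfold angle
  linarith

lemma cos_angle {x y : Fin (d + 1) → ℝ} (hx : x ∈ openSimplex d) (hy : y ∈ openSimplex d) :
    Real.cos (angle x y) = ∑ i, √(x i) * √(y i) := by
  have h := chord_sq_eq hx hy
  have h0 : 0 ≤ ∑ i, √(x i) * √(y i) := Finset.sum_nonneg fun i _ => by positivity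
  have hc := chord_nonneg x y
  rw [angle, Real.cos_two_mul, Real.cos_sq', Real.sin_arcsin (by linarith) (by nlinarith)]
  linarith

/-- Quadratic growth at the minimiser: `f y ≤ f x + L d(x, y)² / 2`, where `d(x, y)` is twice the
angle. -/
lemma le_add_angle_sq {L : ℝ} {f : (Fin (d + 1) → ℝ) → ℝ} (hL : 0 ≤ L)
    (hf : IsGeodesicallySmooth L f) {x y : Fin (d + 1) → ℝ} (hx : x ∈ openSimplex d)
    (hy : y ∈ openSimplex d) (hmin : IsMinOn f (openSimplex d) x) :
    f y ≤ f x + 2 * L * angle x y ^ 2 := by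
  have hcos := cos_angle hx hy
  have hcos0 : 0 < Real.cos (angle x y) := by
    rw [hcos]
    exact Finset.sum_pos (fun i _ => mul_pos (Real.sqrt_pos.2 (hx.1 i)) (Real.sqrt_pos.2 (hy.1 i)))
      Finset.univ_nonempty
  rcases (angle_nonneg x y).eq_or_lt with h0 | h0
  · have h1 : ∑ i, (√(x i) - √(y i)) ^ 2 = 0 := by
      rw [← chord_sq, chord_sq_eq hx hy, ← hcos, ← h0]
      simp
    rw [Finset.sum_eq_zero_iff_of_nonneg fun _ _ => sq_nonneg _] at h1
    have h2 : x = y := by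
      funext i
      have := pow_eq_zero_iff two_ne_zero |>.1 (h1 i (Finset.mem_univ i))
      exact (Real.sqrt_inj (hx.1 i).le (hy.1 i).le).1 (sub_eq_zero.1 this)
    rw [h2]
    have := mul_nonneg (mul_nonneg zero_le_two hL) (sq_nonneg (angle y y))
    linarith
  -- `w` is the unit tangent vector at `√x` that points to `√y`; positivity of the arc is read off
  -- from `(sin (θ - θ t) √x + sin (θ t) √y) / sin θ`.
  · set θ := angle x y with hθ
    have hθpi : θ < Real.pi := by
      refine lt_of_le_of_ne (angle_le_pi x y) fun h => ?_
      rw [h, Real.cos_pi] at hcos0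
      linarith
    have hsin : 0 < Real.sin θ := Real.sin_pos_of_pos_of_lt_pi h0 hθpi
    set w : Fin (d + 1) → ℝ := fun i => (√(y i) - Real.cos θ * √(x i)) / Real.sin θ with hwdef
    have hp := sum_sq_sqrt hx
    have hq := sum_sq_sqrt hy
    have hw : ∑ i, w i ^ 2 = 1 := by
      have : ∀ i, w i ^ 2 = (√(y i) ^ 2 + Real.cos θ ^ 2 * √(x i) ^ 2
          - 2 * Real.cos θ * (√(x i) * √(y i))) / Real.sin θ ^ 2 := fun i => by
        simp only [hwdef, div_pow]; congr 1; ring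
      simp_rw [this, ← Finset.sum_div, Finset.sum_sub_distrib, Finset.sum_add_distrib,
        ← Finset.mul_sum, hp, hq, ← hcos]
      rw [div_eq_one_iff_eq (by positivity), Real.sin_sq]
      ring
    have hpw : ∑ i, √(x i) * w i = 0 := by
      have : ∀ i, √(x i) * w i =
          (√(x i) * √(y i) - Real.cos θ * √(x i) ^ 2) / Real.sin θ := fun i => by
        simp only [hwdef]; ring
      simp_rw [this, ← Finset.sum_div, Finset.sum_sub_distrib, ← Finset.mul_sum, hp, ← hcos]
      simp
    have hpos : ∀ t ∈ Icc (0 : ℝ) 1, ∀ i,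
        0 < Real.cos (θ * t) * √(x i) + Real.sin (θ * t) * w i := by
      intro t ht i
      have e : Real.cos (θ * t) * √(x i) + Real.sin (θ * t) * w i =
          (Real.sin (θ - θ * t) * √(x i) + Real.sin (θ * t) * √(y i)) / Real.sin θ := by
        rw [Real.sin_sub, hwdef]
        field_simp
        ring
      rw [e]
      refine div_pos ?_ hsin
      have hxi := Real.sqrt_pos.2 (hx.1 i)
      have hyi := Real.sqrt_pos.2 (hy.1 i)
      have hs1 : 0 ≤ Real.sin (θ * t) :=
        Real.sin_nonneg_of_nonneg_of_le_pi (mul_nonneg h0.le ht.1) (by nlinarith [ht.2])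
      rcases ht.2.eq_or_lt with h1 | h1
      · rw [h1]; simp only [mul_one, sub_self, Real.sin_zero, zero_mul, zero_add]; positivity
      · have : 0 < Real.sin (θ - θ * t) :=
          Real.sin_pos_of_pos_of_lt_pi (by nlinarith) (by nlinarith [ht.1])
        positivity
    have e0 : greatCircle (fun i => √(x i)) w θ 0 = x := by
      funext i
      simp [greatCircle, Real.sq_sqrt (hx.1 i).le]
    have e1 : greatCircle (fun i => √(x i)) w θ 1 = y := by
      funext i
      have : Real.cos θ * √(x i) + Real.sin θ * w i = √(y i) := by
        rw [hwdef]; field_simp; ring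
      simp [greatCircle, this, Real.sq_sqrt (hy.1 i).le]
    have h := le_add_of_greatCircle hL hf hp hw hpw h0.le hpos (by rwa [e0])
    rwa [e0, e1] at h

/-! ### The Riemannian volume in the chart -/

@[simp] lemma chartInv_castSucc (u : Fin d → ℝ) (i : Fin d) : chartInv u i.castSucc = u i := by
  simp [chartInv]

@[simp] lemma chartInv_last (u : Fin d → ℝ) : chartInv u (Fin.last d) = 1 - ∑ i, u i := by
  simp [chartInv]

lemma sum_chartInv (u : Fin d → ℝ) : ∑ i, chartInv u i = 1 := by
  simp [Fin.sum_univ_castSucc]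

lemma continuous_chartInv : Continuous (chartInv : (Fin d → ℝ) → Fin (d + 1) → ℝ) := by
  refine continuous_pi fun i => ?_
  refine Fin.lastCases ?_ (fun j => ?_) i
  · simp only [chartInv_last]; fun_prop
  · simp only [chartInv_castSucc]; fun_prop

lemma chartInv_init {x : Fin (d + 1) → ℝ} (hx : x ∈ openSimplex d) :
    chartInv (fun i : Fin d => x i.castSucc) = x := by
  have h := hx.2
  rw [Fin.sum_univ_castSucc] at h
  funext i
  refine Fin.lastCases ?_ (fun j => ?_) i
  · rw [chartInv_last]; linarith
  · rw [chartInv_castSucc]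

lemma measurableSet_openSimplex : MeasurableSet (openSimplex d) := by
  have : openSimplex d = (⋂ i, {x : Fin (d + 1) → ℝ | 0 < x i}) ∩ {x | ∑ i, x i = 1} := by
    ext x; simp [openSimplex]
  rw [this]
  exact (MeasurableSet.iInter fun i => measurableSet_lt measurable_const (measurable_pi_apply i)).inter
    (measurableSet_eq_fun (by fun_prop) measurable_const)

lemma measurableSet_chartInv_preimage :
    MeasurableSet (chartInv ⁻¹' openSimplex d : Set (Fin d → ℝ)) :=
  continuous_chartInv.measurable measurableSet_openSimplex

lemma isOpen_chartInv_preimage : IsOpen (chartInv ⁻¹' openSimplex d : Set (Fin d → ℝ)) := by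
  have : (chartInv ⁻¹' openSimplex d : Set (Fin d → ℝ)) = ⋂ i, {u | 0 < chartInv u i} := by
    ext u; simp [openSimplex, sum_chartInv]
  rw [this]
  exact isOpen_iInter_of_finite fun i =>
    isOpen_lt continuous_const ((continuous_apply i).comp continuous_chartInv)

lemma metricMatrix_apply (u : Fin d → ℝ) (i j : Fin d) :
    metricMatrix u i j = (if i = j then (u i)⁻¹ else 0) + (1 - ∑ i, u i)⁻¹ := by
  simp only [metricMatrix, Matrix.of_apply, innerAt, Fin.sum_univ_castSucc, chartInv_castSucc,
    chartInv_last]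
  congr 1
  · rw [Finset.sum_eq_single i]
    · by_cases h : i = j <;> simp [coordVec, h, Fin.castSucc_ne_last]
    · intro k _ hk
      simp [coordVec, Pi.single_apply, hk, Fin.castSucc_ne_last]
    · simp
  · simp [coordVec, (Fin.castSucc_ne_last _).symm]

lemma det_metricMatrix {u : Fin d → ℝ} (hu : ∀ i, chartInv u i ≠ 0) :
    (metricMatrix u).det = (∏ i, chartInv u i)⁻¹ := by
  have hi : ∀ i, u i ≠ 0 := fun i => by simpa using hu i.castSucc
  have hl : 1 - ∑ i, u i ≠ 0 := by simpa using hu (Fin.last d)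
  have h : metricMatrix u = Matrix.diagonal (fun i => (u i)⁻¹) *
      (1 + Matrix.replicateCol Unit (fun i => u i / (1 - ∑ i, u i)) *
        Matrix.replicateRow Unit (fun _ => (1 : ℝ))) := by
    ext i j
    rw [metricMatrix_apply, Matrix.diagonal_mul]
    have := hi i
    by_cases hij : i = j <;> simp [Matrix.mul_apply, hij] <;> field_simp
    subst hij
    field_simp
  rw [h, Matrix.det_mul, Matrix.det_diagonal, Matrix.det_one_add_replicateCol_mul_replicateRow,
    Fin.prod_univ_castSucc]
  simp only [dotProduct, one_mul, chartInv_castSucc, chartInv_last, ← Finset.sum_div,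
    Finset.prod_inv_distrib, mul_inv]
  congr 1
  field_simp
  ring

/-- The density of the Riemannian volume with respect to `du₁ ⋯ du_d`, in terms of the point of
the simplex. -/
noncomputable def volDensity (x : Fin (d + 1) → ℝ) : ℝ := (√(∏ i, x i))⁻¹

lemma measurable_volDensity : Measurable (volDensity : (Fin (d + 1) → ℝ) → ℝ) := by
  unfold volDensity
  fun_prop

lemma volDensity_nonneg (x : Fin (d + 1) → ℝ) : 0 ≤ volDensity x := by
  unfold volDensity; positivity

lemma lintegral_vol {F : (Fin (d + 1) → ℝ) → ℝ≥0∞} (hF : Measurable F) :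
    ∫⁻ x, F x ∂(vol d) = ∫⁻ u in chartInv ⁻¹' openSimplex d,
      ENNReal.ofReal (volDensity (chartInv u)) * F (chartInv u) := by
  have hρ : Measurable fun u : Fin d → ℝ => ENNReal.ofReal (volDensity (chartInv u)) :=
    (measurable_volDensity.comp continuous_chartInv.measurable).ennreal_ofReal
  rw [vol, lintegral_map hF continuous_chartInv.measurable,
    withDensity_congr_ae (g := fun u => ENNReal.ofReal (volDensity (chartInv u))),
    lintegral_withDensity_eq_lintegral_mul _ hρ
      (show Measurable fun u => F (chartInv u) from hF.comp continuous_chartInv.measurable)]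
  · rfl
  · refine (ae_restrict_iff' measurableSet_chartInv_preimage).2 (Eventually.of_forall fun u hu => ?_)
    simp only
    rw [det_metricMatrix fun i => (hu.1 i).ne', volDensity, Real.sqrt_inv]

lemma vol_compl_openSimplex : vol d (openSimplex d)ᶜ = 0 := by
  rw [← lintegral_indicator_one measurableSet_openSimplex.compl,
    lintegral_vol (measurable_one.indicator measurableSet_openSimplex.compl),
    setLIntegral_congr_fun (g := fun _ => 0) measurableSet_chartInv_preimage, lintegral_zero]
  intro u hu
  have : chartInv u ∉ (openSimplex d)ᶜ := fun h => h hu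
  simp [this]

lemma ae_mem_openSimplex : ∀ᵐ x ∂(vol d), x ∈ openSimplex d := vol_compl_openSimplex

/-- The change of charts that replaces the coordinate `k` by the dependent last one. -/
def swapChart (k : Fin d) (u : Fin d → ℝ) : Fin d → ℝ :=
  Function.update u k (1 - ∑ i, u i)

lemma chartInv_swapChart (k : Fin d) (u : Fin d → ℝ) :
    chartInv (swapChart k u) = chartInv u ∘ Equiv.swap k.castSucc (Fin.last d) := by
  funext i
  refine Fin.lastCases ?_ (fun j => ?_) i
  · simp only [chartInv_last, Function.comp_apply, Equiv.swap_apply_right, chartInv_castSucc,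
      swapChart]
    rw [Finset.sum_update_of_mem (Finset.mem_univ k), Finset.sdiff_singleton_eq_erase,
      ← Finset.add_sum_erase Finset.univ u (Finset.mem_univ k)]
    ring
  · by_cases hj : j = k
    · subst hj; simp [swapChart]
    · simp [swapChart, hj, Equiv.swap_apply_of_ne_of_ne, Fin.castSucc_ne_last]

/-- The linear part of `swapChart` is an involution, so its determinant is `±1`. -/
lemma measurePreserving_swapChart (k : Fin d) :
    MeasurePreserving (swapChart k) volume volume := by
  -- `swapChart k` is `T` followed by the translation by `e`.
  let e : Fin d → ℝ := Pi.single k 1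
  let ℓ : (Fin d → ℝ) →ₗ[ℝ] ℝ :=
    -(∑ i : Fin d, LinearMap.proj (R := ℝ) (φ := fun _ : Fin d => ℝ) i) - LinearMap.proj k
  let T : (Fin d → ℝ) →ₗ[ℝ] (Fin d → ℝ) := LinearMap.id + ℓ.smulRight e
  have hℓ : ∀ u, ℓ u = -(∑ i, u i) - u k := fun u => by simp [ℓ]
  have hT : ∀ u, T u = u + ℓ u • e := fun u => by simp [T]
  have hℓe : ℓ e = -2 := by rw [hℓ]; simp [e]; norm_num
  have hTT : T * T = 1 := by
    refine LinearMap.ext fun u => ?_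
    simp only [Module.End.mul_apply, hT, map_add, map_smul, hℓe, Module.End.one_apply, smul_eq_mul]
    module
  have hdet : LinearMap.det T * LinearMap.det T = 1 := by
    rw [← map_mul, hTT, map_one]
  have hT0 : LinearMap.det T ≠ 0 := fun h => by simp [h] at hdet
  have habs : |(LinearMap.det T)⁻¹| = 1 := by
    rcases mul_self_eq_one_iff.1 hdet with h | h <;> simp [h]
  have hTm : MeasurePreserving T volume volume := by
    refine ⟨T.continuous_of_finiteDimensional.measurable, ?_⟩
    rw [Measure.map_linearMap_addHaar_eq_smul_addHaar _ hT0, habs]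
    simp
  convert! (measurePreserving_add_right volume e).comp hTm using 1
  funext u i
  by_cases hi : i = k
  · subst hi; simp [swapChart, hT, hℓ, e]; ring
  · simp [swapChart, hT, hi, e]

/-- The volume is invariant under the exchange of a coordinate with the last one. -/
lemma lintegral_vol_comp_swap (k : Fin (d + 1)) {F : (Fin (d + 1) → ℝ) → ℝ≥0∞}
    (hF : Measurable F) :
    ∫⁻ x, F (x ∘ Equiv.swap k (Fin.last d)) ∂(vol d) = ∫⁻ x, F x ∂(vol d) := by
  revert k
  refine Fin.lastCases (by simp) fun k => ?_
  set σ := Equiv.swap k.castSucc (Fin.last d)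
  have hFσ : Measurable fun x : Fin (d + 1) → ℝ => F (x ∘ σ) :=
    hF.comp (measurable_pi_lambda _ fun i => measurable_pi_apply _)
  have hmem : swapChart k ⁻¹' (chartInv ⁻¹' openSimplex d) = chartInv ⁻¹' openSimplex d := by
    ext u
    simp only [mem_preimage, chartInv_swapChart]
    simp only [openSimplex, mem_ofPred_eq, Function.comp_apply]
    rw [Equiv.sum_comp (Equiv.swap k.castSucc (Fin.last d)) (chartInv u),
      Equiv.forall_congr_right (q := fun i => 0 < chartInv u i)]
  have hρ : Measurable fun u : Fin d → ℝ =>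
      ENNReal.ofReal (volDensity (chartInv u)) * F (chartInv u) :=
    (measurable_volDensity.comp continuous_chartInv.measurable).ennreal_ofReal.mul
      (hF.comp continuous_chartInv.measurable)
  rw [lintegral_vol hFσ, lintegral_vol hF]
  rw [← (measurePreserving_swapChart k).setLIntegral_comp_preimage measurableSet_chartInv_preimage
    hρ, hmem]
  refine lintegral_congr fun u => ?_
  rw [chartInv_swapChart]
  congr 2
  simp only [volDensity, Function.comp_apply]
  rw [Equiv.prod_comp (Equiv.swap k.castSucc (Fin.last d)) (chartInv u)]

/-- Where the last coordinate is bounded below, the density of the volume is dominated by the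
integrable function `∏ uᵢ^(-1/2)`. -/
lemma vol_last_ge_lt_top {δ : ℝ} (hδ : 0 < δ) :
    vol d {x | δ ≤ x (Fin.last d)} < ∞ := by
  have hmeas : MeasurableSet {x : Fin (d + 1) → ℝ | δ ≤ x (Fin.last d)} :=
    measurableSet_le measurable_const (measurable_pi_apply _)
  let g : ℝ → ℝ := (Ioo (0 : ℝ) 1).indicator fun t => t ^ (-(1 / 2) : ℝ)
  have hg : Integrable g := by
    rw [integrable_indicator_iff measurableSet_Ioo]
    have := (intervalIntegral.intervalIntegrable_rpow' (a := 0) (b := 1)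
      (by norm_num : (-1 : ℝ) < -(1 / 2)))
    rw [intervalIntegrable_iff_integrableOn_Ioo_of_le zero_le_one] at this
    exact this
  have hG : Integrable fun u : Fin d → ℝ => (√δ)⁻¹ * ∏ i, g (u i) :=
    (Integrable.fintype_prod (f := fun _ : Fin d => g) fun _ => hg).const_mul _
  rw [← lintegral_indicator_one hmeas, lintegral_vol (measurable_one.indicator hmeas)]
  refine lt_of_le_of_lt ?_ hG.lintegral_lt_top
  refine (setLIntegral_mono' measurableSet_chartInv_preimage fun u hu => ?_).trans
    (setLIntegral_le_lintegral _ _)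
  by_cases h : chartInv u ∈ {x : Fin (d + 1) → ℝ | δ ≤ x (Fin.last d)}
  · rw [indicator_of_mem h, Pi.one_apply, mul_one]
    refine ENNReal.ofReal_le_ofReal ?_
    have hu0 : ∀ i, 0 < u i := fun i => by simpa using hu.1 i.castSucc
    have hu1 : ∀ i, u i < 1 := fun i => by
      have h1 := Finset.single_le_sum (fun j _ => (hu0 j).le) (Finset.mem_univ i)
      have h2 := hu.1 (Fin.last d)
      rw [chartInv_last] at h2
      linarith
    have hgi : ∀ i, g (u i) = (√(u i))⁻¹ := fun i => by
      have : u i ∈ Ioo (0 : ℝ) 1 := ⟨hu0 i, hu1 i⟩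
      simp only [g, indicator_of_mem this]
      rw [Real.rpow_neg (hu0 i).le, Real.sqrt_eq_rpow]
    have h' : δ ≤ chartInv u (Fin.last d) := h
    simp_rw [hgi]
    rw [volDensity, Fin.prod_univ_castSucc, Real.sqrt_mul' _ (hδ.le.trans h'),
      Real.sqrt_eq_rpow (∏ i : Fin d, _), ← Real.finsetProd_rpow _ _ fun i _ => (hu.1 _).le, mul_inv,
      ← Finset.prod_inv_distrib, mul_comm]
    simp only [chartInv_castSucc, ← Real.sqrt_eq_rpow]
    gcongr
  · rw [indicator_of_notMem h, mul_zero]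
    exact zero_le

lemma exists_le_coord {x : Fin (d + 1) → ℝ} (hx : x ∈ openSimplex d) :
    ∃ k, 1 / ((d : ℝ) + 1) ≤ x k := by
  by_contra! hcon
  have h := Finset.sum_lt_sum_of_nonempty (s := Finset.univ) Finset.univ_nonempty
    fun i _ => hcon i
  rw [hx.2] at h
  simp at h
  field_simp at h
  simp at h

/-- The volume is finite: some coordinate is at least `1 / (d + 1)`, and by symmetry it may be
taken to be the last one. -/
instance isFiniteMeasure_vol : IsFiniteMeasure (vol d) := by
  have hδ : (0 : ℝ) < 1 / (d + 1) := by positivity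
  have hmeas : ∀ k, MeasurableSet {x : Fin (d + 1) → ℝ | 1 / ((d : ℝ) + 1) ≤ x k} := fun k =>
    measurableSet_le measurable_const (measurable_pi_apply _)
  have hk : ∀ k, vol d {x | 1 / ((d : ℝ) + 1) ≤ x k} < ∞ := by
    intro k
    have h := lintegral_vol_comp_swap k
      (F := indicator {x | 1 / ((d : ℝ) + 1) ≤ x k} 1) (measurable_one.indicator (hmeas k))
    rw [lintegral_indicator_one (hmeas k)] at h
    rw [← h]
    refine lt_of_eq_of_lt ?_ (vol_last_ge_lt_top (d := d) hδ)
    rw [← lintegral_indicator_one (hmeas _)]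
    refine lintegral_congr fun x => ?_
    simp [indicator_apply]
  refine ⟨lt_of_le_of_lt (measure_mono_ae (t := ⋃ k, {x | 1 / ((d : ℝ) + 1) ≤ x k}) ?_)
    (lt_of_le_of_lt (measure_iUnion_fintype_le _ _) (ENNReal.sum_lt_top.2 fun k _ => hk k))⟩
  filter_upwards [ae_mem_openSimplex] with x hx _
  show x ∈ ⋃ k, {x : Fin (d + 1) → ℝ | 1 / ((d : ℝ) + 1) ≤ x k}
  exact mem_iUnion.2 (exists_le_coord hx)

/-! ### The Laplace integral: uniform lower bound -/

lemma continuous_angle (x : Fin (d + 1) → ℝ) : Continuous (angle x) := by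
  unfold angle chord
  have := Real.continuous_arcsin
  fun_prop

lemma angle_comp_perm (σ : Equiv.Perm (Fin (d + 1))) (x y : Fin (d + 1) → ℝ) :
    angle (x ∘ σ) (y ∘ σ) = angle x y := by
  unfold angle chord
  simp only [Function.comp_apply]
  rw [Equiv.sum_comp σ fun i => (√(x i) - √(y i)) ^ 2]

lemma angle_le_mul_chord (x y : Fin (d + 1) → ℝ) : angle x y ≤ Real.pi / 2 * chord x y := by
  set t := chord x y / 2 with ht
  have ht0 : 0 ≤ t := div_nonneg (chord_nonneg x y) zero_le_two
  have h0 := Real.arcsin_nonneg.2 ht0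
  have h1 := Real.mul_le_sin h0 (Real.arcsin_le_pi_div_two t)
  have h2 : Real.sin (Real.arcsin t) ≤ t := by
    rcases le_total t 1 with h | h
    · rw [Real.sin_arcsin (by linarith) h]
    · exact (Real.sin_le_one _).trans h
  have h3 : Real.arcsin t ≤ Real.pi / 2 * t := by
    have := mul_le_mul_of_nonneg_left (h1.trans h2) (by positivity : 0 ≤ Real.pi / 2)
    field_simp at this ⊢
    linarith
  have h4 : chord x y = 2 * t := by rw [ht]; ring
  rw [angle, ← ht, h4]
  linarith

/-- The integral of `exp (-s d(x, y)² / 2)` over the simplex; twice the angle is the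
Riemannian distance `d(x, y)`. -/
noncomputable def laplaceIntegral (s : ℝ) (x : Fin (d + 1) → ℝ) : ℝ≥0∞ :=
  ∫⁻ y, ENNReal.ofReal (Real.exp (-2 * s * angle x y ^ 2)) ∂(vol d)

lemma measurable_exp_angle (s : ℝ) (x : Fin (d + 1) → ℝ) :
    Measurable fun y => ENNReal.ofReal (Real.exp (-2 * s * angle x y ^ 2)) := by
  have := (continuous_angle x).measurable
  fun_prop

lemma laplaceIntegral_comp_swap (s : ℝ) (x : Fin (d + 1) → ℝ) (k : Fin (d + 1)) :
    laplaceIntegral s (x ∘ Equiv.swap k (Fin.last d)) = laplaceIntegral s x := by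
  unfold laplaceIntegral
  rw [← lintegral_vol_comp_swap k (measurable_exp_angle s _)]
  simp_rw [angle_comp_perm]

lemma sqrt_one_div_pow (s : ℝ) (hs : 0 ≤ s) (d : ℕ) :
    √(1 / s) ^ d = (1 / s) ^ ((d : ℝ) / 2) := by
  rw [Real.sqrt_eq_rpow, ← Real.rpow_natCast, ← Real.rpow_mul (by positivity)]
  congr 1
  ring

lemma sq_sqrt_sub_sqrt_le {a b : ℝ} (ha : 0 ≤ a) (hb : 0 < b) :
    (√b - √a) ^ 2 ≤ (a - b) ^ 2 / b := by
  rw [le_div_iff₀ hb]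
  have h1 := Real.sq_sqrt ha
  have h2 := Real.sq_sqrt hb.le
  have h3 : a - b = (√a - √b) * (√a + √b) := by linear_combination h2 - h1
  have h4 : √b ^ 2 ≤ (√a + √b) ^ 2 := by
    gcongr; linarith [Real.sqrt_nonneg a]
  calc (√b - √a) ^ 2 * b = (√a - √b) ^ 2 * √b ^ 2 := by rw [h2]; ring
    _ ≤ (√a - √b) ^ 2 * (√a + √b) ^ 2 := by gcongr
    _ = _ := by rw [h3]; ring

/-- If the last coordinate of `x` is not small, the box of the points with
`√xᵢ ≤ √yᵢ ≤ √xᵢ + r` for `i ≠ n` lies in the simplex, within distance of order `r` of `x`,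
and has volume at least `r ^ d`. -/
lemma le_laplaceIntegral_of_last {x : Fin (d + 1) → ℝ} (hx : x ∈ openSimplex d)
    (hlast : 1 / ((d : ℝ) + 1) ≤ x (Fin.last d)) {r s : ℝ} (hr : 0 < r) (hs : 0 ≤ s)
    (hr1 : r ≤ 1 / (3 * ((d : ℝ) + 1) ^ 2)) :
    ENNReal.ofReal (r ^ d * Real.exp (-(80 * ((d : ℝ) + 1) ^ 3) * (s * r ^ 2))) ≤
      laplaceIntegral s x := by
  set N : ℝ := (d : ℝ) + 1 with hN
  have hN1 : 1 ≤ N := by rw [hN]; linarith [(Nat.cast_nonneg d : (0 : ℝ) ≤ d)]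
  have hrN : r * (3 * N ^ 2) ≤ 1 := by rwa [le_div_iff₀ (by positivity)] at hr1
  have hr1' : r ≤ 1 := by nlinarith
  have hsq : ∀ i, √(x i) ^ 2 = x i := fun i => Real.sq_sqrt (hx.1 i).le
  have hsq1 : ∀ i, √(x i) ≤ 1 := fun i => by
    refine Real.sqrt_le_one.2 ?_
    rw [← hx.2]
    exact Finset.single_le_sum (fun j _ => (hx.1 j).le) (Finset.mem_univ i)
  set lo : Fin d → ℝ := fun i => x i.castSucc with hlo
  set hi : Fin d → ℝ := fun i => (√(x i.castSucc) + r) ^ 2 with hhi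
  set P : ℝ := ∏ i : Fin d, (√(x i.castSucc) + r) with hP
  have hP0 : 0 < P := Finset.prod_pos fun i _ => by positivity
  -- All `uᵢ` change by at most `2 √xᵢ r + r² ≤ 3 r`, hence the last coordinate by at most `3 d r`.
  have hdiff : ∀ u ∈ Icc lo hi, |(∑ i, u i) - ∑ i, lo i| ≤ 3 * d * r := by
    intro u hu
    rw [← Finset.sum_sub_distrib, abs_of_nonneg (Finset.sum_nonneg fun i _ => sub_nonneg.2 (hu.1 i))]
    calc ∑ i, (u i - lo i) ≤ ∑ _i : Fin d, 3 * r := by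
          refine Finset.sum_le_sum fun i _ => ?_
          have h1 := hu.2 i
          simp only [hlo, hhi] at h1 ⊢
          nlinarith [hsq i.castSucc, hsq1 i.castSucc]
      _ = 3 * d * r := by simp; ring
  have hxl : x (Fin.last d) = 1 - ∑ i, lo i := by
    have h := hx.2
    rw [Fin.sum_univ_castSucc] at h
    simp only [hlo]; linarith
  have hdrN : 3 * d * r < 1 / N := by
    rw [lt_div_iff₀ (by positivity)]
    have h1 : (d : ℝ) = N - 1 := by rw [hN]; ring
    rw [h1]
    nlinarith [mul_pos hr (by positivity : 0 < N)]
  have hyl : ∀ u ∈ Icc lo hi, 0 < chartInv u (Fin.last d) := by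
    intro u hu
    have := (abs_le.1 (hdiff u hu)).2
    rw [chartInv_last]
    linarith
  have hmem : Icc lo hi ⊆ chartInv ⁻¹' openSimplex d := by
    intro u hu
    refine ⟨Fin.lastCases (hyl u hu) fun i => ?_, sum_chartInv u⟩
    rw [chartInv_castSucc]
    exact (hx.1 i.castSucc).trans_le (hu.1 i)
  have hsqrt_le : ∀ u ∈ Icc lo hi, ∀ i, √(u i) ≤ √(x i.castSucc) + r := by
    intro u hu i
    rw [Real.sqrt_le_left (by positivity)]
    exact hu.2 i
  have hangle : ∀ u ∈ Icc lo hi, angle x (chartInv u) ^ 2 ≤ 40 * N ^ 3 * r ^ 2 := by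
    intro u hu
    have hchord : chord x (chartInv u) ^ 2 ≤ 10 * N ^ 3 * r ^ 2 := by
      rw [chord_sq, Fin.sum_univ_castSucc]
      have h1 : ∑ i : Fin d, (√(x i.castSucc) - √(chartInv u i.castSucc)) ^ 2 ≤ d * r ^ 2 := by
        calc _ ≤ ∑ _i : Fin d, r ^ 2 := by
              refine Finset.sum_le_sum fun i _ => ?_
              rw [chartInv_castSucc]
              have h1 := hsqrt_le u hu i
              have h2 : √(x i.castSucc) ≤ √(u i) := Real.sqrt_le_sqrt (hu.1 i)
              exact sq_le_sq' (by linarith) (by linarith)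
          _ = d * r ^ 2 := by simp
      have h2 : (√(x (Fin.last d)) - √(chartInv u (Fin.last d))) ^ 2 ≤ 9 * d ^ 2 * r ^ 2 * N := by
        refine (sq_sqrt_sub_sqrt_le (hyl u hu).le (hx.1 _)).trans ?_
        have h3 : (chartInv u (Fin.last d) - x (Fin.last d)) ^ 2 ≤ (3 * d * r) ^ 2 := by
          rw [chartInv_last, hxl]
          have := abs_le.1 (hdiff u hu)
          exact sq_le_sq' (by linarith) (by linarith)
        calc _ ≤ (3 * d * r) ^ 2 / (1 / N) := by gcongr
          _ = _ := by field_simp; ring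
      have h4 : (d : ℝ) ≤ N := by rw [hN]; linarith
      have h5 : (d : ℝ) * r ^ 2 ≤ N ^ 3 * r ^ 2 := by
        gcongr
        exact h4.trans (le_self_pow₀ hN1 (by norm_num))
      have h6 : 9 * (d : ℝ) ^ 2 * r ^ 2 * N ≤ 9 * N ^ 2 * r ^ 2 * N := by gcongr
      linarith
    have hpi : (Real.pi / 2) ^ 2 ≤ 4 := by nlinarith [Real.pi_pos, Real.pi_le_four]
    calc angle x (chartInv u) ^ 2 ≤ (Real.pi / 2 * chord x (chartInv u)) ^ 2 := by
          gcongr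
          · exact angle_nonneg _ _
          · exact angle_le_mul_chord _ _
      _ = (Real.pi / 2) ^ 2 * chord x (chartInv u) ^ 2 := by ring
      _ ≤ 4 * (10 * N ^ 3 * r ^ 2) := by gcongr
      _ = _ := by ring
  have hdens : ∀ u ∈ Icc lo hi, P⁻¹ ≤ volDensity (chartInv u) := by
    intro u hu
    have hpos := (hmem hu).1
    unfold volDensity
    have h0 : 0 < √(∏ i, chartInv u i) := Real.sqrt_pos.2 (Finset.prod_pos fun i _ => hpos i)
    refine inv_anti₀ h0 ?_
    rw [Real.sqrt_le_left hP0.le, Fin.prod_univ_castSucc, hP, ← Finset.prod_pow]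
    have h1 : chartInv u (Fin.last d) ≤ 1 := by
      rw [← sum_chartInv u]
      exact Finset.single_le_sum (fun j _ => (hpos j).le) (Finset.mem_univ _)
    refine (mul_le_of_le_one_right (Finset.prod_nonneg fun i _ => (hpos _).le) h1).trans ?_
    refine Finset.prod_le_prod (fun i _ => (hpos _).le) fun i _ => ?_
    rw [chartInv_castSucc]
    exact hu.2 i
  set E : ℝ := Real.exp (-(80 * N ^ 3) * (s * r ^ 2)) with hE
  -- The side `2 √xᵢ r + r²` of the box is at least `r (√xᵢ + r)`, and the product of the factors
  -- `√xᵢ + r` cancels against the density.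
  have hvol : r ^ d * E ≤ P⁻¹ * E * ∏ i, (hi i - lo i) := by
    have h1 : r ^ d * P ≤ ∏ i, (hi i - lo i) := by
      rw [hP, ← Fin.prod_const, ← Finset.prod_mul_distrib]
      refine Finset.prod_le_prod (fun i _ => by positivity) fun i _ => ?_
      simp only [hlo, hhi]
      nlinarith [hsq i.castSucc, mul_nonneg hr.le (Real.sqrt_nonneg (x i.castSucc))]
    calc r ^ d * E = P⁻¹ * E * (r ^ d * P) := by field_simp
      _ ≤ _ := by gcongr
  calc ENNReal.ofReal (r ^ d * E) ≤ ENNReal.ofReal (P⁻¹ * E * ∏ i, (hi i - lo i)) :=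
        ENNReal.ofReal_le_ofReal hvol
    _ = ∫⁻ _u in Icc lo hi, ENNReal.ofReal (P⁻¹ * E) := by
        have hle : ∀ i, 0 ≤ hi i - lo i := fun i => by
          simp only [hlo, hhi]
          nlinarith [hsq i.castSucc, mul_nonneg hr.le (Real.sqrt_nonneg (x i.castSucc))]
        rw [setLIntegral_const, Real.volume_Icc_pi, ← ENNReal.ofReal_prod_of_nonneg fun i _ => hle i,
          ENNReal.ofReal_mul (by positivity)]
    _ ≤ ∫⁻ u in Icc lo hi, ENNReal.ofReal (volDensity (chartInv u)) *
          ENNReal.ofReal (Real.exp (-2 * s * angle x (chartInv u) ^ 2)) := by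
        refine setLIntegral_mono' measurableSet_Icc fun u hu => ?_
        rw [← ENNReal.ofReal_mul (volDensity_nonneg _)]
        refine ENNReal.ofReal_le_ofReal (mul_le_mul (hdens u hu) ?_ (by positivity)
          (volDensity_nonneg _))
        rw [hE]
        refine Real.exp_le_exp.2 ?_
        have := mul_le_mul_of_nonneg_left (hangle u hu) hs
        linarith
    _ ≤ ∫⁻ u in chartInv ⁻¹' openSimplex d, ENNReal.ofReal (volDensity (chartInv u)) *
          ENNReal.ofReal (Real.exp (-2 * s * angle x (chartInv u) ^ 2)) :=
        lintegral_mono_set hmem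
    _ = laplaceIntegral s x := (lintegral_vol (measurable_exp_angle s x)).symm

/-- The lower bound of the Laplace integral that is uniform in the base point. -/
lemma exists_le_laplaceIntegral (d : ℕ) {s₀ : ℝ} (hs₀ : 0 < s₀) :
    ∃ c : ℝ, 0 < c ∧ ∀ x ∈ openSimplex d, ∀ s, s₀ ≤ s →
      ENNReal.ofReal (c * (1 / s) ^ ((d : ℝ) / 2)) ≤ laplaceIntegral s x := by
  set ρ : ℝ := √s₀ / (3 * ((d : ℝ) + 1) ^ 2) with hρ
  have hρ0 : 0 < ρ := by positivity
  refine ⟨ρ ^ d * Real.exp (-(80 * ((d : ℝ) + 1) ^ 3) * ρ ^ 2), by positivity, ?_⟩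
  intro x hx s hs
  have hs0 : 0 < s := hs₀.trans_le hs
  obtain ⟨k, hk⟩ := exists_le_coord hx
  rw [← laplaceIntegral_comp_swap s x k]
  set σ := Equiv.swap k (Fin.last d)
  have hxσ : x ∘ σ ∈ openSimplex d := by
    refine ⟨fun i => hx.1 _, ?_⟩
    rw [← hx.2]
    exact Equiv.sum_comp σ x
  have hr : ρ * √(1 / s) ≤ 1 / (3 * ((d : ℝ) + 1) ^ 2) := by
    rw [hρ, div_mul_eq_mul_div]
    gcongr
    rw [← Real.sqrt_mul hs₀.le, mul_one_div]
    exact Real.sqrt_le_one.2 ((div_le_one hs0).2 hs)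
  refine le_of_eq_of_le ?_ (le_laplaceIntegral_of_last hxσ (by simpa [σ] using hk)
    (r := ρ * √(1 / s)) (by positivity) hs0.le hr)
  rw [mul_pow, mul_pow, Real.sq_sqrt (by positivity), ← sqrt_one_div_pow s hs0.le]
  congr 1
  rw [show s * (ρ ^ 2 * (1 / s)) = ρ ^ 2 by field_simp]
  ring

/-! ### The Laplace integral: asymptotic lower bound -/

lemma lintegral_exp_neg_half_sum_sq (d : ℕ) :
    ∫⁻ z : Fin d → ℝ, ENNReal.ofReal (Real.exp (-(1 / 2) * ∑ i, z i ^ 2)) =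
      ENNReal.ofReal ((2 * Real.pi) ^ ((d : ℝ) / 2)) := by
  have hexp : ∀ z : Fin d → ℝ, Real.exp (-(1 / 2) * ∑ i, z i ^ 2) =
      ∏ i, Real.exp (-(1 / 2) * z i ^ 2) := fun z => by
    rw [Finset.mul_sum, Real.exp_sum]
  simp_rw [hexp]
  have hint : Integrable fun z : Fin d → ℝ => ∏ i, Real.exp (-(1 / 2) * z i ^ 2) :=
    Integrable.fintype_prod (f := fun _ t => Real.exp (-(1 / 2) * t ^ 2))
      fun _ => integrable_exp_neg_mul_sq (by norm_num)
  rw [← ofReal_integral_eq_lintegral_ofReal hint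
    (Eventually.of_forall fun z => Finset.prod_nonneg fun i _ => (Real.exp_pos _).le)]
  congr 1
  rw [integral_fintype_prod_volume_eq_pow (fun t : ℝ => Real.exp (-(1 / 2) * t ^ 2)),
    integral_gaussian, Fintype.card_fin, Real.sqrt_eq_rpow, ← Real.rpow_natCast,
    ← Real.rpow_mul (by positivity)]
  congr 1 <;> ring

open scoped MatrixOrder in
/-- The Gaussian integral of a positive semidefinite non-degenerate quadratic form. -/
lemma sqrt_det_mul_lintegral_exp_neg_half {M : Matrix (Fin d) (Fin d) ℝ} (hM : M.PosSemidef)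
    (hdet : M.det ≠ 0) :
    ENNReal.ofReal √M.det *
      ∫⁻ z : Fin d → ℝ, ENNReal.ofReal (Real.exp (-(1 / 2) * (z ⬝ᵥ M.mulVec z))) =
      ENNReal.ofReal ((2 * Real.pi) ^ ((d : ℝ) / 2)) := by
  obtain ⟨B, rfl⟩ := CStarAlgebra.nonneg_iff_eq_star_mul_self.mp hM.nonneg
  rw [Matrix.star_eq_conjTranspose, Matrix.conjTranspose_eq_transpose_of_trivial,
    Matrix.det_mul, Matrix.det_transpose] at hdet ⊢
  have hB : LinearMap.det (Matrix.toLin' B) ≠ 0 := by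
    rw [LinearMap.det_toLin']
    exact fun h => hdet (by simp [h])
  have hquad : ∀ z, z ⬝ᵥ (B.transpose * B).mulVec z = ∑ i, Matrix.toLin' B z i ^ 2 := fun z => by
    rw [← Matrix.mulVec_mulVec, Matrix.dotProduct_mulVec, Matrix.vecMul_transpose]
    simp [dotProduct, sq]
  have hmeas : Measurable fun z : Fin d → ℝ =>
      ENNReal.ofReal (Real.exp (-(1 / 2) * ∑ i, z i ^ 2)) := by fun_prop
  have h := lintegral_map (μ := volume) hmeas
    (Matrix.toLin' B).continuous_of_finiteDimensional.measurable
  rw [Measure.map_linearMap_addHaar_eq_smul_addHaar _ hB, lintegral_smul_measure,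
    lintegral_exp_neg_half_sum_sq] at h
  simp_rw [hquad]
  rw [← h, Real.sqrt_mul_self_eq_abs, smul_eq_mul, ← mul_assoc, ← ENNReal.ofReal_mul (abs_nonneg _),
    ← abs_mul, LinearMap.det_toLin', mul_inv_cancel₀ (by rwa [LinearMap.det_toLin'] at hB)]
  simp

/-- The tangent vector with components `z` in the chart. -/
noncomputable def chartVec (z : Fin d → ℝ) : Fin (d + 1) → ℝ :=
  Fin.snoc (α := fun _ => ℝ) z (-∑ i, z i)

lemma chartVec_castSucc (z : Fin d → ℝ) (i : Fin d) : chartVec z i.castSucc = z i := by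
  simp [chartVec]

lemma chartVec_last (z : Fin d → ℝ) : chartVec z (Fin.last d) = -∑ i, z i := by
  simp [chartVec]

lemma chartInv_add_smul (u z : Fin d → ℝ) (ε : ℝ) :
    chartInv (u + ε • z) = chartInv u + ε • chartVec z := by
  funext i
  refine Fin.lastCases ?_ (fun j => ?_) i
  · simp [chartVec_last, Finset.sum_add_distrib, ← Finset.mul_sum]; ring
  · simp [chartVec_castSucc]

lemma dotProduct_metricMatrix_mulVec (u z : Fin d → ℝ) :
    z ⬝ᵥ (metricMatrix u).mulVec z = innerAt (chartInv u) (chartVec z) (chartVec z) := by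
  have h : ∀ i, (metricMatrix u).mulVec z i = (u i)⁻¹ * z i + (1 - ∑ i, u i)⁻¹ * ∑ j, z j :=
    fun i => by
      simp only [Matrix.mulVec, dotProduct, metricMatrix_apply, add_mul, Finset.sum_add_distrib,
        ite_mul, zero_mul, Finset.sum_ite_eq, Finset.mem_univ, if_true, Finset.mul_sum]
  simp only [dotProduct, h, innerAt, Fin.sum_univ_castSucc, chartVec_castSucc, chartVec_last,
    chartInv_castSucc, chartInv_last, mul_add, Finset.sum_add_distrib, ← Finset.sum_mul]
  congr 1
  · exact Finset.sum_congr rfl fun i _ => by ring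
  · ring

lemma posSemidef_metricMatrix {u : Fin d → ℝ} (hu : ∀ i, 0 < chartInv u i) :
    (metricMatrix u).PosSemidef := by
  refine .of_dotProduct_mulVec_nonneg ?_ fun z => ?_
  · ext i j
    simp only [Matrix.conjTranspose_apply, star_trivial, metricMatrix_apply]
    by_cases hij : i = j
    · simp [hij]
    · simp [hij, Ne.symm hij]
  · rw [star_trivial, dotProduct_metricMatrix_mulVec]
    exact Finset.sum_nonneg fun i _ => div_nonneg (mul_self_nonneg _) (hu i).le

/-- The Gaussian integral over the tangent space at a point of the simplex. -/
lemma lintegral_tangent_gaussian {x : Fin (d + 1) → ℝ} (hx : x ∈ openSimplex d) :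
    ∫⁻ z : Fin d → ℝ, ENNReal.ofReal (volDensity x) *
      ENNReal.ofReal (Real.exp (-(1 / 2) * innerAt x (chartVec z) (chartVec z))) =
      ENNReal.ofReal ((2 * Real.pi) ^ ((d : ℝ) / 2)) := by
  have hxu := chartInv_init hx
  set u : Fin d → ℝ := fun i => x i.castSucc
  have hpos : ∀ i, 0 < chartInv u i := fun i => by rw [hxu]; exact hx.1 i
  have hdet := det_metricMatrix fun i => (hpos i).ne'
  rw [lintegral_const_mul' _ _ ENNReal.ofReal_ne_top,
    ← sqrt_det_mul_lintegral_exp_neg_half (posSemidef_metricMatrix hpos)]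
  · simp_rw [dotProduct_metricMatrix_mulVec, hdet, hxu, Real.sqrt_inv]
    rfl
  · rw [hdet]
    exact inv_ne_zero (Finset.prod_ne_zero_iff.2 fun i _ => (hpos i).ne')

/-- Infinitesimally, twice the angle is the Riemannian norm. -/
lemma tendsto_angle_sq_div {x : Fin (d + 1) → ℝ} (hx : x ∈ openSimplex d)
    (v : Fin (d + 1) → ℝ) :
    Tendsto (fun ε : ℝ => 4 * angle x (x + ε • v) ^ 2 / ε ^ 2) (𝓝[>] 0) (𝓝 (innerAt x v v)) := by
  have hsq : ∀ i, √(x i) ^ 2 = x i := fun i => Real.sq_sqrt (hx.1 i).le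
  have hchord : Tendsto (fun ε : ℝ => chord x (x + ε • v) ^ 2 / ε ^ 2) (𝓝[>] 0)
      (𝓝 (∑ i, (v i / (2 * √(x i))) ^ 2)) := by
    simp_rw [chord_sq, Finset.sum_div]
    refine tendsto_finsetSum _ fun i _ => ?_
    have h1 : HasDerivAt (fun ε : ℝ => √(x i + ε * v i)) (v i / (2 * √(x i))) 0 := by
      have h2 : HasDerivAt (fun ε : ℝ => x i + ε * v i) (v i) 0 := by
        simpa using ((hasDerivAt_id (0 : ℝ)).mul_const (v i)).const_add (x i)
      simpa using h2.sqrt (by simpa using (hx.1 i).ne')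
    have h3 := (hasDerivAt_iff_tendsto_slope_zero.1 h1).mono_left
      (nhdsWithin_mono 0 fun t (ht : 0 < t) => ht.ne' : 𝓝[>] (0 : ℝ) ≤ 𝓝[≠] 0)
    refine (h3.pow 2).congr fun ε => ?_
    simp only [zero_add, zero_mul, add_zero, smul_eq_mul, Pi.add_apply, Pi.smul_apply]
    ring
  have hchord0 : Tendsto (fun ε : ℝ => chord x (x + ε • v) / 2) (𝓝[>] 0) (𝓝 0) := by
    have hc : Continuous fun ε : ℝ => chord x (x + ε • v) / 2 := by
      unfold chord
      simp only [Pi.add_apply, Pi.smul_apply, smul_eq_mul]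
      fun_prop
    have := (hc.tendsto 0).mono_left (nhdsWithin_le_nhds (s := Ioi 0))
    simpa [chord] using this
  -- `arcsin t = t D(t)` with `D` continuous and `D 0 = 1`; unlike the quotient `arcsin t / t`, this
  -- covers the case `v = 0`, where the chord vanishes.
  have hD : Tendsto (dslope Real.arcsin 0) (𝓝 0) (𝓝 1) := by
    have h1 : HasDerivAt Real.arcsin 1 0 := by
      simpa using Real.hasDerivAt_arcsin (x := 0) (by norm_num) (by norm_num)
    have h2 := (continuousAt_dslope_same.2 h1.differentiableAt).tendsto
    rwa [dslope_same, h1.deriv] at h2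
  have h := (hchord.mul ((hD.comp hchord0).pow 2)).const_mul 4
  have hlim : 4 * ((∑ i, (v i / (2 * √(x i))) ^ 2) * 1 ^ 2) = innerAt x v v := by
    rw [innerAt, one_pow, mul_one, Finset.mul_sum]
    refine Finset.sum_congr rfl fun i _ => ?_
    rw [div_pow, mul_pow, hsq]
    have := (hx.1 i).ne'
    field_simp
    ring
  rw [hlim] at h
  refine h.congr fun ε => ?_
  have := sub_smul_dslope Real.arcsin 0 (chord x (x + ε • v) / 2)
  simp only [sub_zero, Real.arcsin_zero, smul_eq_mul] at this
  rw [angle, ← this, Function.comp_apply]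
  ring

/-- Zooming in at `x = chartInv a` by the factor `ε = s^(-1/2)`. -/
lemma laplaceIntegral_eq_rescaled (x : Fin (d + 1) → ℝ) (a : Fin d → ℝ) {ε : ℝ} (hε : 0 < ε) :
    laplaceIntegral (1 / ε ^ 2) x = ENNReal.ofReal (ε ^ d) *
      ∫⁻ z, (chartInv ⁻¹' openSimplex d).indicator (fun u =>
        ENNReal.ofReal (volDensity (chartInv u)) *
          ENNReal.ofReal (Real.exp (-2 * (1 / ε ^ 2) * angle x (chartInv u) ^ 2))) (a + ε • z) := by
  have hmeas : Measurable ((chartInv ⁻¹' openSimplex d).indicator (fun u : Fin d → ℝ =>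
      ENNReal.ofReal (volDensity (chartInv u)) *
        ENNReal.ofReal (Real.exp (-2 * (1 / ε ^ 2) * angle x (chartInv u) ^ 2)))) :=
    ((measurable_volDensity.comp continuous_chartInv.measurable).ennreal_ofReal.mul
      ((measurable_exp_angle _ x).comp continuous_chartInv.measurable)).indicator
      measurableSet_chartInv_preimage
  rw [laplaceIntegral, lintegral_vol (measurable_exp_angle _ x),
    ← lintegral_indicator measurableSet_chartInv_preimage]
  generalize (chartInv ⁻¹' openSimplex d).indicator (fun u : Fin d → ℝ =>
      ENNReal.ofReal (volDensity (chartInv u)) *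
        ENNReal.ofReal (Real.exp (-2 * (1 / ε ^ 2) * angle x (chartInv u) ^ 2))) = G at hmeas ⊢
  have h := lintegral_map (μ := (volume : Measure (Fin d → ℝ))) (f := fun u => G (a + u))
    (g := fun z => ε • z) (by fun_prop) (by fun_prop)
  rw [Measure.map_addHaar_smul _ hε.ne', lintegral_smul_measure, lintegral_add_left_eq_self,
    Module.finrank_fin_fun, abs_of_pos (by positivity)] at h
  rw [← h, smul_eq_mul, ← mul_assoc, ← ENNReal.ofReal_mul (by positivity),
    mul_inv_cancel₀ (by positivity), ENNReal.ofReal_one, one_mul]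

/-- Laplace asymptotics: by Fatou's lemma, the rescaled integrals are asymptotically bounded below
by the Gaussian integral over the tangent space. -/
lemma exists_laplaceIntegral_ge_of_lt {x : Fin (d + 1) → ℝ} (hx : x ∈ openSimplex d) {c : ℝ}
    (hc : c < (2 * Real.pi) ^ ((d : ℝ) / 2)) :
    ∃ s₀ : ℝ, 0 < s₀ ∧ ∀ s, s₀ ≤ s →
      ENNReal.ofReal (c * (1 / s) ^ ((d : ℝ) / 2)) ≤ laplaceIntegral s x := by
  have hxa := chartInv_init hx
  set a : Fin d → ℝ := fun i => x i.castSucc with ha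
  set H : ℝ → (Fin d → ℝ) → ℝ≥0∞ := fun ε z => (chartInv ⁻¹' openSimplex d).indicator (fun u =>
    ENNReal.ofReal (volDensity (chartInv u)) *
      ENNReal.ofReal (Real.exp (-2 * (1 / ε ^ 2) * angle x (chartInv u) ^ 2))) (a + ε • z) with hH
  have hmeas : ∀ ε, Measurable (H ε) := fun ε =>
    (((measurable_volDensity.comp continuous_chartInv.measurable).ennreal_ofReal.mul
      ((measurable_exp_angle _ x).comp continuous_chartInv.measurable)).indicator
      measurableSet_chartInv_preimage).comp (by fun_prop)
  have hline : ∀ z : Fin d → ℝ, Tendsto (fun ε : ℝ => a + ε • z) (𝓝[>] 0) (𝓝 a) := fun z => by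
    have h : Continuous fun ε : ℝ => a + ε • z := by fun_prop
    simpa using (h.tendsto 0).mono_left (nhdsWithin_le_nhds (s := Ioi 0))
  have hmem : ∀ z : Fin d → ℝ, ∀ᶠ ε : ℝ in 𝓝[>] 0, a + ε • z ∈ chartInv ⁻¹' openSimplex d :=
    fun z => (hline z).eventually
      (isOpen_chartInv_preimage.mem_nhds (by rw [mem_preimage, hxa]; exact hx))
  have hlim : ∀ z, Tendsto (fun ε => H ε z) (𝓝[>] 0) (𝓝 (ENNReal.ofReal (volDensity x) *
      ENNReal.ofReal (Real.exp (-(1 / 2) * innerAt x (chartVec z) (chartVec z))))) := by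
    intro z
    have h1 : Tendsto (fun ε : ℝ => volDensity (chartInv (a + ε • z))) (𝓝[>] 0)
        (𝓝 (volDensity x)) := by
      have hprod : √(∏ i, x i) ≠ 0 :=
        (Real.sqrt_pos.2 (Finset.prod_pos fun i _ => hx.1 i)).ne'
      have hcont : ContinuousAt (volDensity : (Fin (d + 1) → ℝ) → ℝ) x := by
        unfold volDensity
        exact ContinuousAt.inv₀ (by fun_prop) hprod
      refine hcont.tendsto.comp ?_
      rw [← hxa]
      exact (continuous_chartInv.tendsto a).comp (hline z)
    have h2 : Tendsto (fun ε : ℝ => Real.exp (-2 * (1 / ε ^ 2) *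
        angle x (chartInv (a + ε • z)) ^ 2)) (𝓝[>] 0)
        (𝓝 (Real.exp (-(1 / 2) * innerAt x (chartVec z) (chartVec z)))) := by
      refine (Real.continuous_exp.tendsto _).comp ?_
      refine ((tendsto_angle_sq_div hx (chartVec z)).const_mul (-(1 / 2))).congr fun ε => ?_
      rw [chartInv_add_smul, hxa]
      ring
    rw [← ENNReal.ofReal_mul (volDensity_nonneg _)]
    refine (ENNReal.tendsto_ofReal (h1.mul h2)).congr' ?_
    filter_upwards [hmem z] with ε hε
    simp only [hH]
    rw [indicator_of_mem hε, ENNReal.ofReal_mul (volDensity_nonneg _)]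
  have hfatou := lintegral_liminf_le (μ := volume) (u := 𝓝[>] (0 : ℝ)) hmeas
  simp_rw [fun z => (hlim z).liminf_eq] at hfatou
  rw [lintegral_tangent_gaussian hx] at hfatou
  have hlt : ENNReal.ofReal c < liminf (fun ε => ∫⁻ z, H ε z) (𝓝[>] (0 : ℝ)) :=
    ((ENNReal.ofReal_lt_ofReal_iff (by positivity)).2 hc).trans_le hfatou
  have hev := eventually_lt_of_lt_liminf hlt
  obtain ⟨ε₀, hε₀, hε⟩ := mem_nhdsGT_iff_exists_Ioc_subset.1 hev
  have hε₀' : (0 : ℝ) < ε₀ := hε₀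
  refine ⟨1 / ε₀ ^ 2, by positivity, fun s hs => ?_⟩
  have hs0 : 0 < s := lt_of_lt_of_le (by positivity) hs
  have hε1 : 0 < √(1 / s) := Real.sqrt_pos.2 (by positivity)
  have hε2 : √(1 / s) ≤ ε₀ := by
    rw [Real.sqrt_le_left hε₀'.le]
    exact (one_div_le (by positivity) hs0).1 hs
  have hs' : s = 1 / √(1 / s) ^ 2 := by rw [Real.sq_sqrt (by positivity), one_div_one_div]
  have hb : ENNReal.ofReal c < ∫⁻ z, H √(1 / s) z := hε ⟨hε1, hε2⟩
  rw [← sqrt_one_div_pow s hs0.le, mul_comm, ENNReal.ofReal_mul (by positivity)]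
  conv_rhs => rw [hs']
  rw [laplaceIntegral_eq_rescaled x a hε1]
  exact mul_le_mul_right hb.le _

/-! ### Mean and entropy of the Gibbs density -/

lemma IsGeodesicallySmooth.continuousOn {L : ℝ} {f : (Fin (d + 1) → ℝ) → ℝ}
    (hf : IsGeodesicallySmooth L f) : ContinuousOn f (openSimplex d) := by
  obtain ⟨grad, hgrad, -⟩ := hf
  exact fun x hx => (hgrad x hx).2.continuousWithinAt

lemma IsGeodesicallySmooth.aestronglyMeasurable {L : ℝ} {f : (Fin (d + 1) → ℝ) → ℝ}
    (hf : IsGeodesicallySmooth L f) : AEStronglyMeasurable f (vol d) := by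
  have h := hf.continuousOn.aestronglyMeasurable (μ := vol d) measurableSet_openSimplex
  rwa [Measure.restrict_eq_self_of_ae_mem ae_mem_openSimplex] at h

/-- A geodesically smooth function with an interior minimiser is bounded, since the simplex
has finite diameter. -/
lemma IsGeodesicallySmooth.ae_mem_Icc {L : ℝ} {f : (Fin (d + 1) → ℝ) → ℝ} (hL : 0 ≤ L)
    (hf : IsGeodesicallySmooth L f) {xs : Fin (d + 1) → ℝ} (hxs : xs ∈ openSimplex d)
    (hmin : IsMinOn f (openSimplex d) xs) :
    ∀ᵐ y ∂(vol d), f y ∈ Icc (f xs) (f xs + 2 * L * Real.pi ^ 2) := by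
  filter_upwards [ae_mem_openSimplex] with y hy
  refine ⟨hmin hy, (le_add_angle_sq hL hf hxs hy hmin).trans ?_⟩
  have := angle_nonneg xs y
  have := angle_le_pi xs y
  gcongr

/-- `h(ν) = β 𝔼 f + log Λ`, so a lower bound for `Λ exp (β f*) = ∫ exp (-β (f - f*))` bounds
`𝔼 f - f*` by the entropy. -/
lemma gibbs_bound {L β : ℝ} {f : (Fin (d + 1) → ℝ) → ℝ} (hL : 0 ≤ L) (hβ : 0 < β)
    (hf : IsGeodesicallySmooth L f) {xs : Fin (d + 1) → ℝ} (hxs : xs ∈ openSimplex d)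
    (hmin : IsMinOn f (openSimplex d) xs) {κ : ℝ} (hκ : 0 < κ)
    (hbound : ENNReal.ofReal κ ≤ laplaceIntegral (β * L) xs) :
    GibbsWellDefined f β ∧
      |gibbsMean f β - f xs| ≤ gibbsEntropy f β / β + 1 / β * Real.log κ⁻¹ := by
  have hmeas := hf.aestronglyMeasurable
  have hIcc := hf.ae_mem_Icc hL hxs hmin
  have hfint : Integrable f (vol d) :=
    Integrable.of_mem_Icc _ _ hmeas.aemeasurable hIcc
  have hexpmeas : AEStronglyMeasurable (fun x => Real.exp (-β * f x)) (vol d) :=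
    Real.continuous_exp.comp_aestronglyMeasurable (hmeas.const_mul (-β))
  have hexpbd : ∀ᵐ x ∂(vol d), ‖Real.exp (-β * f x)‖ ≤ Real.exp (-β * f xs) := by
    filter_upwards [hIcc] with x hx
    rw [Real.norm_of_nonneg (Real.exp_pos _).le]
    refine Real.exp_le_exp.2 ?_
    have := mul_le_mul_of_nonneg_left hx.1 hβ.le
    linarith
  have hexp : Integrable (fun x => Real.exp (-β * f x)) (vol d) :=
    Integrable.of_bound hexpmeas _ hexpbd
  set Λ := partitionFn f β with hΛdef
  have hκΛ : κ * Real.exp (-β * f xs) ≤ Λ := by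
    have h1 : ENNReal.ofReal (κ * Real.exp (-β * f xs)) ≤ ENNReal.ofReal Λ := by
      rw [mul_comm, ENNReal.ofReal_mul (Real.exp_pos _).le, hΛdef, partitionFn,
        ofReal_integral_eq_lintegral_ofReal hexp (Eventually.of_forall fun x => (Real.exp_pos _).le)]
      calc _ ≤ ENNReal.ofReal (Real.exp (-β * f xs)) * laplaceIntegral (β * L) xs := by gcongr
        _ ≤ _ := by
          rw [laplaceIntegral, ← lintegral_const_mul' _ _ ENNReal.ofReal_ne_top]
          refine lintegral_mono_ae ?_
          filter_upwards [ae_mem_openSimplex] with y hy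
          rw [← ENNReal.ofReal_mul (Real.exp_pos _).le, ← Real.exp_add]
          refine ENNReal.ofReal_le_ofReal (Real.exp_le_exp.2 ?_)
          have := mul_le_mul_of_nonneg_left (le_add_angle_sq hL hf hxs hy hmin) hβ.le
          linarith
    exact (ENNReal.ofReal_le_ofReal_iff (integral_nonneg fun x => (Real.exp_pos _).le)).1 h1
  have hκ' : 0 < κ * Real.exp (-β * f xs) := by positivity
  have hΛ : 0 < Λ := hκ'.trans_le hκΛ
  have hν : Integrable (gibbs f β) (vol d) := hexp.div_const Λ
  have hν0 : ∀ x, 0 ≤ gibbs f β x := fun x => div_nonneg (Real.exp_pos _).le hΛ.le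
  have hν1 : ∫ x, gibbs f β x ∂(vol d) = 1 := by
    simp only [gibbs]
    rw [integral_div]
    exact div_self hΛ.ne'
  have hfν : Integrable (fun x => f x * gibbs f β x) (vol d) := by
    refine hν.bdd_mul (c := max |f xs| |f xs + 2 * L * Real.pi ^ 2|) hmeas ?_
    filter_upwards [hIcc] with x hx
    exact abs_le_max_abs_abs hx.1 hx.2
  have hlog : ∀ x, gibbs f β x * Real.log (gibbs f β x) =
      -β * (f x * gibbs f β x) - Real.log Λ * gibbs f β x := by
    intro x
    have : Real.log (gibbs f β x) = -β * f x - Real.log Λ := by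
      rw [gibbs, Real.log_div (Real.exp_pos _).ne' hΛ.ne', Real.log_exp]
    rw [this]
    ring
  have hνlog : Integrable (fun x => gibbs f β x * Real.log (gibbs f β x)) (vol d) := by
    simp_rw [hlog]
    exact (hfν.const_mul _).sub (hν.const_mul _)
  refine ⟨⟨hexp, hΛ, hfν, hνlog⟩, ?_⟩
  have hent : gibbsEntropy f β = β * gibbsMean f β + Real.log Λ := by
    rw [gibbsEntropy]
    simp_rw [hlog]
    rw [integral_sub (hfν.const_mul _) (hν.const_mul _), integral_const_mul, integral_const_mul,
      hν1, gibbsMean]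
    ring
  have hmean : f xs ≤ gibbsMean f β := by
    have h : ∫ x, f xs * gibbs f β x ∂(vol d) ≤ gibbsMean f β := by
      refine integral_mono_ae (hν.const_mul _) hfν ?_
      filter_upwards [hIcc] with x hx
      exact mul_le_mul_of_nonneg_right hx.1 (hν0 x)
    rwa [integral_const_mul, hν1, mul_one] at h
  have hlogΛ := Real.log_le_log hκ' hκΛ
  rw [Real.log_mul hκ.ne' (Real.exp_pos _).ne', Real.log_exp] at hlogΛ
  rw [abs_of_nonneg (sub_nonneg.2 hmean), hent, Real.log_inv, div_add' _ _ _ hβ.ne',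
    le_div_iff₀ hβ]
  field_simp
  linarith

end Shahshahani

theorem mainTheorem3 (d : ℕ) :
    (∀ s₀ : ℝ, 0 < s₀ → ∃ c : ℝ, 0 < c ∧
      ∀ (L : ℝ) (f : (Fin (d + 1) → ℝ) → ℝ) (xs : Fin (d + 1) → ℝ), 0 < L →
        Shahshahani.IsGeodesicallySmooth L f →
        xs ∈ Shahshahani.openSimplex d → IsMinOn f (Shahshahani.openSimplex d) xs →
        ∀ (B : Set ℝ) (K : ℝ), B ⊆ Set.Ioi 0 →
          (∀ β ∈ B, Shahshahani.gibbsEntropy f β ≤ K) →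
          ∀ β ∈ B, s₀ ≤ β * L →
            Shahshahani.GibbsWellDefined f β ∧
            |Shahshahani.gibbsMean f β - f xs| ≤
              K / β + 1 / β * Real.log ((c * (1 / (β * L)) ^ ((d : ℝ) / 2))⁻¹)) ∧
    (∀ (xs : Fin (d + 1) → ℝ), xs ∈ Shahshahani.openSimplex d →
      ∀ c : ℝ, 0 < c → c < (2 * Real.pi) ^ ((d : ℝ) / 2) → ∃ s₀ : ℝ, 0 < s₀ ∧
        ∀ (L : ℝ) (f : (Fin (d + 1) → ℝ) → ℝ), 0 < L →
          Shahshahani.IsGeodesicallySmooth L f →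
          IsMinOn f (Shahshahani.openSimplex d) xs →
          ∀ (B : Set ℝ) (K : ℝ), B ⊆ Set.Ioi 0 →
            (∀ β ∈ B, Shahshahani.gibbsEntropy f β ≤ K) →
            ∀ β ∈ B, s₀ ≤ β * L →
              |Shahshahani.gibbsMean f β - f xs| ≤
                K / β + 1 / β * Real.log ((c * (1 / (β * L)) ^ ((d : ℝ) / 2))⁻¹)) := by
  open Shahshahani in
  have key : ∀ {L β c K : ℝ} {f : (Fin (d + 1) → ℝ) → ℝ} {xs : Fin (d + 1) → ℝ} {B : Set ℝ},
      0 < L → IsGeodesicallySmooth L f → xs ∈ openSimplex d → IsMinOn f (openSimplex d) xs →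
      B ⊆ Set.Ioi 0 → (∀ β ∈ B, gibbsEntropy f β ≤ K) → β ∈ B → 0 < c →
      ENNReal.ofReal (c * (1 / (β * L)) ^ ((d : ℝ) / 2)) ≤ laplaceIntegral (β * L) xs →
      GibbsWellDefined f β ∧ |gibbsMean f β - f xs| ≤
        K / β + 1 / β * Real.log ((c * (1 / (β * L)) ^ ((d : ℝ) / 2))⁻¹) := by
    intro L β c K f xs B hL hf hxs hmin hB hK hβ hc hbound
    have hβ0 : 0 < β := hB hβ
    obtain ⟨h1, h2⟩ := gibbs_bound hL.le hβ0 hf hxs hmin (by positivity) hbound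
    refine ⟨h1, h2.trans ?_⟩
    have := div_le_div_of_nonneg_right (hK β hβ) hβ0.le
    linarith
  constructor
  · intro s₀ hs₀
    obtain ⟨c, hc, h⟩ := Shahshahani.exists_le_laplaceIntegral d hs₀
    exact ⟨c, hc, fun L f xs hL hf hxs hmin B K hB hK β hβ hs =>
      key hL hf hxs hmin hB hK hβ hc (h xs hxs _ hs)⟩
  · intro xs hxs c hc hc'
    obtain ⟨s₀, hs₀, h⟩ := Shahshahani.exists_laplaceIntegral_ge_of_lt hxs hc'
    exact ⟨s₀, hs₀, fun L f hL hf hmin B K hB hK β hβ hs =>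
      (key hL hf hxs hmin hB hK hβ hc (h _ hs)).2⟩
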